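/- Logarithms: $\log=\log_2$. For integers $m\ge1$, $d\ge 2$ put $p=2^{-m}$, $q=2^{-m/2}$, $w=\lfloor m2^m/\log e\rfloor$, $\lambda=(\log w)^{3/2}/w^{5/4}$, $$t_{d-1}=\frac{p-\lambda}{q},\qquad t_{k-1}=\frac{(1-t_k)^{qw}-\lambda}{q}\quad(k=d-1,\dots,2).$$ Let $w_{d-1}=m$, let $w_k=w$ for $1\le k\le d-2$, let $w_0$ be the least integer with $(1-t_1)^{qw_0}\le\frac12$, and let $n=w_0w_1\cdots w_{d-1}$. Let $A_0$ be a one-point set and $A_k=A_{k-1}\times[w_{k-1}]$, so $|A_d|=n$. *Restrictions and projections.* A restriction on $A_k$ is a $\rho\in\{0,1,\ast\}^{A_k}$. For $f:\{0,1\}^{A_k}\to\{0,1\}$ its $\rho$-projection is the function $\mathrm{proj}_\rho f$ on $\{0,1\}^{A_{k-1}}$ given by $(\mathrm{proj}_\rho f)(y)=f(x)$, where $x_{a,i}=y_a$ if $\rho_{a,i}=\ast$ and $x_{a,i}=\rho_{a,i}$ otherwise. At level $k$ the symbol $\circ$ denotes $1$ if $d-k$ is even and $0$ if $d-k$ is odd,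 and $\bullet$ is its complement. The lift $\hat\tau\in\{0,1,\ast\}^{A_{k-1}}$ of $\tau\in\{0,1,\ast\}^{A_k}$ has $\hat\tau_a$ equal (in level-$k$ symbols) to $\bullet$ if some $\tau_{a,i}=\bullet$, to $\circ$ if all $\tau_{a,i}=\circ$, and to $\ast$ otherwise. We write $\{x_t,y_{1-t}\}^S$ for the product distribution, and $\{x_t,y_{1-t}\}^S\setminus\{y\}^S$ for this distribution conditioned on not being constantly $y$. *The random projection $\mathbf\Psi$.* $\mathcal R_{\mathrm{init}}$ is the distribution on $\{0,1,\ast\}^{A_d}$ whose blocks $\rho_a$, $a\in A_{d-1}$, are independent, each being $1^m$ with probability $\lambda$, drawn from $\{\ast_{1/2},1_{1/2}\}^m\setminus\{1\}^m$ with probability $q$, and drawn from $\{0_{1/2},1_{1/2}\}^m\setminus\{1\}^m$ with probability $1-\lambda-q$. For $2\le k\le d-1$ and $\tau\in\{0,1,\ast\}^{A_k}$, the distribution $\mathcal R(\tau)$ leaves the non-$\ast$ coordinates of $\tau$ unchanged and, independently for each $a\in A_{k-1}$, with $S_a=\{i:\tau_{a,i}=\ast\}$: if $\hat\tau_a=\ast$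 and $\big||S_a|-qw\big|\le w^{1/3+(d-k-1)/(12d)}$, then $\rho(S_a)$ is $\circ^{S_a}$ with probability $\lambda$, is drawn from $\{\ast_{t_k},\circ_{1-t_k}\}^{S_a}\setminus\{\circ\}^{S_a}$ with probability $q_a:=\big((1-t_k)^{|S_a|}-\lambda\big)/t_{k-1}$, and from $\{\bullet_{t_k},\circ_{1-t_k}\}^{S_a}\setminus\{\circ\}^{S_a}$ with probability $1-\lambda-q_a$; otherwise $\rho(S_a)$ is drawn from $\{\bullet_{t_k},\circ_{1-t_k}\}^{S_a}$. Finally, for $f:\{0,1\}^{A_d}\to\{0,1\}$, $$\mathbf\Psi(f)=\mathrm{proj}_{\rho^{(2)}}\cdots\mathrm{proj}_{\rho^{(d)}}f:\{0,1\}^{A_1}\to\{0,1\},\qquad \rho^{(d)}\leftarrow\mathcal R_{\mathrm{init}},\quad \rho^{(k)}\leftarrow\mathcal R\big(\widehat{\rho^{(k+1)}}\big)\ (2\le k\le d-1).$$ *Circuits.* A depth-$d$ circuit has unbounded fan-in AND/OR gates arranged in $d$ layers, with the output gate in the top layer and gate types alternating from layer to layer; the inputs of a gate are literals and, above the bottom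 layer, gates of the layer directly below. Gates may be shared. The size is the number of gates, and the bottom fan-in is the largest fan-in of a gate in the bottom layer. **Theorem.** There are absolute constants $c>0$, $\kappa>0$ and $m_0$ such that for all integers $m\ge m_0$ and $2\le d\le \frac{c\,m}{\log m}$ the following holds. All the numbers used above as probabilities are probabilities: $\lambda\ge0$, $\lambda+q\le1$, $0<t_k<1$ for $1\le k\le d-1$, and $q_a\ge0$, $\lambda+q_a\le1$ whenever $2\le k\le d-1$ and $\big||S_a|-qw\big|\le w^{1/3+(d-k-1)/(12d)}$. Moreover, for every depth-$d$ circuit $C:\{0,1\}^{A_d}\to\{0,1\}$ of size at most $2^{n^{1/(6(d-1))}}$ and bottom fan-in at most $\frac{\log n}{10(d-1)}$, $$\Pr\big[\mathbf\Psi(C)\text{ is computed by a decision tree of depth at most } n^{\frac1{4(d-1)}}\big]\ \ge\ 1-\exp\!\big(-\kappa\, n^{\frac1{6(d-1)}}\big).$$ -/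

import Mathlib

open scoped BigOperators

noncomputable section

namespace SipserProj

/-! ### Boolean functions, layered alternating circuits, decision trees -/

/-- Boolean functions on the variables indexed by `V`. -/
abbrev BoolFun (V : Type) : Type := (V → Bool) → Bool

/-- Restrictions of the variables indexed by `V`; `none` is the symbol `∗`. -/
abbrev Restr (V : Type) : Type := V → Option Bool

/-- A layered alternating circuit with `d` layers of gates (shared gates and unbounded fan-in are
allowed).  Layer `i` holds the gates at distance `i + 1` from the bottom, so layer `0` is the bottom
layer (the gates at depth `d - 1`), and the output gate is in layer `d - 1`.  A gate takes as inputs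
literals (`(v, b)` is the literal that is true iff the variable `v` has value `b`) and, above the
bottom layer, gates of the layer just below it.  The gate types alternate from layer to layer. -/
structure LayeredCircuit (V : Type) (d : ℕ) where
  /-- the number of gates in each layer -/
  numGates : ℕ → ℕ
  /-- whether the bottom gates are AND gates (otherwise they are OR gates) -/
  bottomIsAnd : Bool
  /-- the literals that feed a gate -/
  lits : (i : ℕ) → Fin (numGates i) → Finset (V × Bool)
  /-- the gates of the layer below that feed a gate -/
  kids : (i : ℕ) → Fin (numGates (i + 1)) → Finset (Fin (numGates i))
  /-- the output gate -/
  output : Fin (numGates (d - 1))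

namespace LayeredCircuit

variable {V : Type} {d : ℕ}

/-- Whether the gates in layer `i` are AND gates. -/
def isAnd (C : LayeredCircuit V d) (i : ℕ) : Bool :=
  if Even i then C.bottomIsAnd else !C.bottomIsAnd

open Classical in
/-- The value of a gate on the input `x`. -/
def gateVal (C : LayeredCircuit V d) (x : V → Bool) : (i : ℕ) → Fin (C.numGates i) → Bool
  | 0, g =>
      if C.isAnd 0 then decide (∀ l ∈ C.lits 0 g, x l.1 = l.2)
      else decide (∃ l ∈ C.lits 0 g, x l.1 = l.2)
  | i + 1, g =>
      if C.isAnd (i + 1) then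
        decide ((∀ l ∈ C.lits (i + 1) g, x l.1 = l.2) ∧ ∀ h ∈ C.kids i g, C.gateVal x i h = true)
      else
        decide ((∃ l ∈ C.lits (i + 1) g, x l.1 = l.2) ∨ ∃ h ∈ C.kids i g, C.gateVal x i h = true)

/-- The function computed by the circuit. -/
def eval (C : LayeredCircuit V d) : BoolFun V := fun x => C.gateVal x (d - 1) C.output

/-- The size of a circuit is its number of gates. -/
def size (C : LayeredCircuit V d) : ℕ := ∑ i ∈ Finset.range d, C.numGates i

/-- The largest fan-in of a gate in the bottom layer. -/
def bottomFanIn (C : LayeredCircuit V d) : ℕ :=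
  Finset.univ.sup fun g : Fin (C.numGates 0) => (C.lits 0 g).card

end LayeredCircuit

/-- Decision trees over the variables indexed by `V`. -/
inductive DTree (V : Type) : Type
  | leaf : Bool → DTree V
  | node : V → DTree V → DTree V → DTree V

namespace DTree

variable {V : Type}

/-- `node v T₀ T₁` queries `v`, and continues with `T₀` if `v = 0` and with `T₁` if `v = 1`. -/
def eval : DTree V → (V → Bool) → Bool
  | leaf b, _ => b
  | node v T₀ T₁, x => if x v then T₁.eval x else T₀.eval x

/-- The largest number of queries on a root-to-leaf path. -/
def depth : DTree V → ℕ
  | leaf _ => 0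
  | node _ T₀ T₁ => max T₀.depth T₁.depth + 1

end DTree

/-- `f` is computed by a decision tree of depth at most `r`. -/
def ComputedByDTree {V : Type} (f : BoolFun V) (r : ℝ) : Prop :=
  ∃ T : DTree V, (T.depth : ℝ) ≤ r ∧ ∀ x, T.eval x = f x

/-! ### Parameters -/

/-- `w = ⌊m 2^m / log₂ e⌋`. -/
def wPar (m : ℕ) : ℕ := ⌊(m : ℝ) * 2 ^ m / Real.logb 2 (Real.exp 1)⌋₊

/-- `p = 2^(-m)`. -/
def pPar (m : ℕ) : ℝ := (2 : ℝ) ^ (-(m : ℝ))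

/-- `q = √p = 2^(-m/2)`. -/
def qPar (m : ℕ) : ℝ := (2 : ℝ) ^ (-(m : ℝ) / 2)

/-- `lam = (log₂ w)^(3/2) / w^(5/4)`. -/
def lamPar (m : ℕ) : ℝ :=
  Real.logb 2 (wPar m) ^ (3 / 2 : ℝ) / (wPar m : ℝ) ^ (5 / 4 : ℝ)

/-- `tAux m j` is the parameter `t_k` with `k = d - 1 - j`. -/
def tAux (m : ℕ) : ℕ → ℝ
  | 0 => (pPar m - lamPar m) / qPar m
  | j + 1 => ((1 - tAux m j) ^ (qPar m * wPar m) - lamPar m) / qPar m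

/-- The parameters `t_{d-1}, …, t_1`: `t_{d-1} = (p - lam) / q` and
`t_{k-1} = ((1 - t_k)^(q w) - lam) / q`. -/
def tPar (m d k : ℕ) : ℝ := tAux m (d - 1 - k)

/-- `w_0` is the least integer with `(1 - t_1)^(q w_0) ≤ 1/2`. -/
def w0Par (m d : ℕ) : ℕ := sInf {N : ℕ | (1 - tPar m d 1) ^ (qPar m * N) ≤ 1 / 2}

/-- The fan-ins `w_0, …, w_{d-1}`: `w_{d-1} = m`, and `w_k = w` for `1 ≤ k ≤ d - 2`. -/
def fanIn (m d k : ℕ) : ℕ := if k = d - 1 then m else if k = 0 then w0Par m d else wPar m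

/-- The number of variables `n = w_0 w_1 ⋯ w_{d-1}`. -/
def numVars (m d : ℕ) : ℕ := ∏ k ∈ Finset.range d, fanIn m d k

/-! ### Addresses -/

/-- The address sets: `A_0` is a point and `A_{k+1} = A_k × [w_k]`. -/
@[reducible] def Addr (w : ℕ → ℕ) : ℕ → Type
  | 0 => Unit
  | k + 1 => Addr w k × Fin (w k)

instance Addr.instDecidableEq (w : ℕ → ℕ) : (k : ℕ) → DecidableEq (Addr w k)
  | 0 => inferInstanceAs (DecidableEq Unit)
  | k + 1 =>
    have := Addr.instDecidableEq w k
    inferInstanceAs (DecidableEq (Addr w k × Fin (w k)))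

instance Addr.instFintype (w : ℕ → ℕ) : (k : ℕ) → Fintype (Addr w k)
  | 0 => inferInstanceAs (Fintype Unit)
  | k + 1 =>
    have := Addr.instFintype w k
    inferInstanceAs (Fintype (Addr w k × Fin (w k)))

/-- The addresses of the `(m, d)` formula; `A_d` indexes the `n` input variables. -/
abbrev SAddr (m d k : ℕ) : Type := Addr (fanIn m d) k

/-! ### Projections and lifts -/

/-- The `ρ`-projection: every variable of block `a` left free by `ρ` is replaced by `y_a`. -/
def proj {A : Type} {l : ℕ} (ρ : Restr (A × Fin l)) (f : BoolFun (A × Fin l)) : BoolFun A :=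
  fun y => f fun x => (ρ x).getD (y x.1)

/-- The value of the symbol `∘` at level `k`; the symbol `•` is its complement. -/
def circ (d k : ℕ) : Bool := decide (Even (d - k))

/-- The lift of `τ`, where `c` is the value of `∘` at the level of `τ` (hence the value of `•` at
the level of the lift). -/
def lift {A : Type} {l : ℕ} (c : Bool) (τ : Restr (A × Fin l)) : Restr A := fun a =>
  if ∃ i, τ (a, i) = some (!c) then some (!c)
  else if ∀ i, τ (a, i) = some c then some c
  else none

/-! ### The random restrictions -/

open Classical in
/-- The law on a finite type with the given weights (a point mass if these are not the weights of a
probability distribution). -/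
def lawOf {α : Type} [Fintype α] [Inhabited α] (W : α → ℝ) : PMF α :=
  if h : (∀ a, 0 ≤ W a) ∧ ∑ a, W a = 1 then
    PMF.ofFintype (fun a => ENNReal.ofReal (W a)) (by
      rw [← ENNReal.ofReal_sum_of_nonneg fun a _ => h.1 a, h.2, ENNReal.ofReal_one])
  else PMF.pure default

section Block

variable {l : ℕ}

/-- The number of free coordinates `|S|`, `S = τ⁻¹(∗)`, of a block `τ`. -/
def stars (τ : Fin l → Option Bool) : ℕ := (Finset.univ.filter fun i => τ i = none).card

/-- The block `τ` with all of its free coordinates set to `c`. -/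
def fill (c : Bool) (τ : Fin l → Option Bool) : Fin l → Option Bool := fun i => some ((τ i).getD c)

/-- The weight of `σ` when the free coordinates of `τ` are drawn from `{x_t, c_{1-t}}^S`, and the
other coordinates are kept. -/
def prodWeight (x : Option Bool) (c : Bool) (t : ℝ) (τ σ : Fin l → Option Bool) : ℝ :=
  ∏ i, if τ i = none then (if σ i = x then t else if σ i = some c then 1 - t else 0)
    else if σ i = τ i then 1 else 0

/-- The same for `{x_t, c_{1-t}}^S ∖ {c}^S`, the product distribution conditioned on not being
constantly `c`. -/
def condWeight (x : Option Bool) (c : Bool) (t : ℝ) (τ σ : Fin l → Option Bool) : ℝ :=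
  if σ = fill c τ then 0 else prodWeight x c t τ σ / (1 - (1 - t) ^ stars τ)

/-- The weight of `σ` when the free coordinates of `τ` are drawn from the mixture of `c^S` with
probability `lam`, `{∗_t, c_{1-t}}^S ∖ {c}^S` with probability `q`, and
`{(¬c)_t, c_{1-t}}^S ∖ {c}^S` with probability `1 - lam - q`. -/
def mixWeight (lam q : ℝ) (c : Bool) (t : ℝ) (τ σ : Fin l → Option Bool) : ℝ :=
  (if σ = fill c τ then lam else 0) + q * condWeight none c t τ σ
    + (1 - lam - q) * condWeight (some (!c)) c t τ σ

end Block

/-- `k`-acceptability of a set of `s` children: `s = q w ± w^β(k,d)`, where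
`β(k,d) = 1/3 + (d - k - 1) / (12 d)`. -/
def Acceptable (m d k s : ℕ) : Prop :=
  |(s : ℝ) - qPar m * wPar m| ≤
    (wPar m : ℝ) ^ (1 / 3 + ((d : ℝ) - k - 1) / (12 * d))

/-- `q_a = ((1 - t_k)^s - lam) / t_{k-1}`, where `s = |S_a|`. -/
def qBlock (m d k s : ℕ) : ℝ := ((1 - tPar m d k) ^ s - lamPar m) / tPar m d (k - 1)

/-- The initial distribution `R_init` over restrictions of `A_{j+1} = A_j × [w_j]` (used with
`j + 1 = d`): the blocks are independent, and every block is `1^m` with probability `lam`, is drawn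
from `{∗_{1/2}, 1_{1/2}}^m ∖ {1}^m` with probability `q`, and from `{0_{1/2}, 1_{1/2}}^m ∖ {1}^m`
with probability `1 - lam - q`. -/
def rInit (m d j : ℕ) : PMF (Restr (SAddr m d (j + 1))) :=
  lawOf fun ρ => ∏ a : SAddr m d j,
    mixWeight (lamPar m) (qPar m) true (1 / 2) (fun _ => none) (fun i => ρ (a, i))

open Classical in
/-- The weight of the block `σ` in the subsequent distribution at level `k`, given the block `τ` of
the previous restriction and its lift `liftVal`. -/
def blockWeight (m d k : ℕ) (liftVal : Option Bool) {l : ℕ} (τ σ : Fin l → Option Bool) : ℝ :=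
  if liftVal = none ∧ Acceptable m d k (stars τ) then
    mixWeight (lamPar m) (qBlock m d k (stars τ)) (circ d k) (tPar m d k) τ σ
  else prodWeight (some (!circ d k)) (circ d k) (tPar m d k) τ σ

/-- The subsequent distribution `R(τ)` over refinements of `τ ∈ {0,1,∗}^{A_k}`, where `k = j + 1`;
the blocks are independent. -/
def rNext (m d j : ℕ) (τ : Restr (SAddr m d (j + 1))) : PMF (Restr (SAddr m d (j + 1))) :=
  lawOf fun ρ => ∏ a : SAddr m d j,
    blockWeight m d (j + 1) (lift (circ d (j + 1)) τ a) (fun i => τ (a, i)) (fun i => ρ (a, i))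

/-- The stages `k = j + 1, …, 2` of the random projection, applied to `f` over `A_{j+1}`, when the
lift of the previous restriction is `τ`. -/
def psiFrom (m d : ℕ) :
    (j : ℕ) → Restr (SAddr m d (j + 1)) → BoolFun (SAddr m d (j + 1)) →
      PMF (BoolFun (SAddr m d 1))
  | 0, _, f => PMF.pure f
  | j + 1, τ, f =>
      (rNext m d (j + 1) τ).bind fun ρ => psiFrom m d j (lift (circ d (j + 2)) ρ) (proj ρ f)

/-- The law of the random projection
`Ψ(f) = proj_{ρ^(2)} proj_{ρ^(3)} ⋯ proj_{ρ^(d)} f`, where `ρ^(d)` is drawn from `R_init` and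
`ρ^(k)` is drawn from `R(lift of ρ^(k+1))` for `2 ≤ k ≤ d - 1` (meaningful for `d ≥ 2`). -/
def psi (m : ℕ) : (d : ℕ) → BoolFun (SAddr m d d) → PMF (BoolFun (SAddr m d 1))
  | 0, _ => PMF.pure fun _ => false
  | 1, f => PMF.pure f
  | e + 2, f =>
      (rInit m (e + 2) (e + 1)).bind fun ρ =>
        psiFrom m (e + 2) e (lift (circ (e + 2) (e + 2)) ρ) (proj ρ f)

/-- All the numbers used as probabilities in the definitions of `R_init` and `R(τ)` are
probabilities. -/
def ParamsValid (m d : ℕ) : Prop :=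
  0 ≤ lamPar m ∧ lamPar m + qPar m ≤ 1 ∧
  (∀ k, 1 ≤ k → k ≤ d - 1 → 0 < tPar m d k ∧ tPar m d k < 1) ∧
  ∀ k s, 2 ≤ k → k ≤ d - 1 → Acceptable m d k s →
    0 ≤ qBlock m d k s ∧ lamPar m + qBlock m d k s ≤ 1

/-- The probability that `Ψ(f)` is computed by a decision tree of depth at most `r`. -/
def probShallow (m d : ℕ) (f : BoolFun (SAddr m d d)) (r : ℝ) : ℝ :=
  ((psi m d f).toOuterMeasure {g | ComputedByDTree g r}).toReal

end SipserProj

end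

/-! Each stage of the projection collapses one layer of the circuit. If all gates of a layer are
decision trees of depth `s`, a gate of the next layer is, up to negation, a DNF of width `s`, and a
switching lemma for random projections turns it back into a tree of depth `s` except with
probability `ε ^ (s + 1)`. A union bound over the gates makes the total failure at most `size * ε ^
(s + 1)`. With `ε = 1/4`, `N = n^(1/(6(d-1)))` and `s = ⌊N⌋` this is at most `2^N * 4^(-N) = exp(-N
log 2)`; the depth reached is thus even below `n^(1/(4(d-1)))`.

The switching lemma `sum_bad_le` is an induction on the terms of the DNF, for products of block
weights and relative to an arbitrary nonnegative function `G` that is monotone under refinement. If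
the first term `T` is falsified, the induction hypothesis applies to `G` cut down to that event.
Otherwise let `B` be the set of blocks in which `T` still has a free coordinate. Setting the free
coordinates of these blocks as `T` demands satisfies `T`; by `BlockGood` this gains a factor `δ` per
block, and induction with the blocks of `B` answered gains `ε ^ (s - |B|)`. Falsifying and
satisfying `T` are disjoint events, both preserved by refinement, so the two contributions add up to
at most `ε ^ s` times the mass of `G`, once the sum over `B` and the answers, at most `(1 + 2δ/ε)^r
- 1`, is at most 1.

`BlockGood` holds for every block, whatever the earlier stages produced (`blockGood_mixWeight`,
`blockGood_prodWeight`): replacing `∗` by `•` compares the part of weight `q` in the mixture with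
the part of weight `1 - λ - q`, and an image that is constantly `∘` is paid for by the weight `λ`. A
block of unacceptable size receives no star at all, so no typicality of the restrictions is needed.
What remains is numerical: `t_k` stays close to `q`, `λ` is `p^(5/4)` up to powers of `m`, and `δ`
is small. The bound on `d` is what controls the error accumulated in the recursion for `t_k`. -/

open scoped BigOperators

noncomputable section

namespace SipserProj

/-! ### The switching lemma for products of block weights. -/

section Core

open Classical

variable {A : Type} [Fintype A] [DecidableEq A] {l : ℕ}

/-- Every value fixed by `x` is also fixed, in the same way, by `y`. -/
def Refines (x y : Fin l → Option Bool) : Prop := ∀ i v, x i = some v → y i = some v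

/-- The block `x` falsifies the partial assignment `U`. -/
def Falsifies (U x : Fin l → Option Bool) : Prop := ∃ i v, U i = some v ∧ x i = some (!v)

/-- The partial assignment `U` mentions a free coordinate of the block `x`. -/
def Live (U x : Fin l → Option Bool) : Prop := ∃ i, U i ≠ none ∧ x i = none

/-- The free coordinates of `x` are set as `U` demands, and to `b` where `U` is silent. -/
def encode (b : Bool) (U x : Fin l → Option Bool) : Fin l → Option Bool :=
  fun i => some ((x i).getD ((U i).getD b))

/-- The weight of the preimages with free coordinates under an encoding is at most `δ` times the
weight of the image. -/
def BlockGood (b : Bool) (r : ℕ) (δ : ℝ) (μ : (Fin l → Option Bool) → ℝ) : Prop :=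
  (∀ x, 0 ≤ μ x) ∧ ∀ U : Fin l → Option Bool, (Finset.univ.filter fun i => U i ≠ none).card ≤ r →
    ∀ y, ∑ x, (if (∃ i, x i = none) ∧ encode b U x = y then μ x else 0) ≤ δ * μ y

/-- The blocks in which the term `T` has a coordinate left free by `ρ`. -/
def liveSet (T ρ : A → Fin l → Option Bool) : Finset A :=
  Finset.univ.filter fun a => Live (T a) (ρ a)

/-- The blocks mentioned by a term. -/
def touched (T : A → Fin l → Option Bool) : Finset A :=
  Finset.univ.filter fun a => ∃ i, T a i ≠ none

/-- Answers to the queries of the blocks in `B`; those in `P` are answered `1`. -/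
def setOn (B P : Finset A) (ρ : A → Fin l → Option Bool) : A → Fin l → Option Bool :=
  fun a => if a ∈ B then fill (decide (a ∈ P)) (ρ a) else ρ a

/-- The canonical decision tree of the projected DNF `F` has a path of length at least `s`. -/
def Bad : List (A → Fin l → Option Bool) → ℕ → (A → Fin l → Option Bool) → Prop
  | [], s, _ => s = 0
  | T :: F, s, ρ => s = 0 ∨ ((∃ a, Falsifies (T a) (ρ a)) ∧ Bad F s ρ) ∨
      ((∀ a, ¬ Falsifies (T a) (ρ a)) ∧ (liveSet T ρ).Nonempty ∧
        ∃ P ⊆ liveSet T ρ, Bad F (s - (liveSet T ρ).card) (setOn (liveSet T ρ) P ρ))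

theorem Bad_zero (F : List (A → Fin l → Option Bool)) (ρ : A → Fin l → Option Bool) :
    Bad F 0 ρ := by
  cases F with
  | nil => rfl
  | cons T F => exact Or.inl rfl

theorem Refines.refl (x : Fin l → Option Bool) : Refines x x := fun _ _ h => h

theorem Refines.falsifies {U x y : Fin l → Option Bool} (h : Refines x y) (hx : Falsifies U x) :
    Falsifies U y := by
  obtain ⟨i, v, hU, hx⟩ := hx
  exact ⟨i, v, hU, h _ _ hx⟩

theorem Refines.trans {x y z : Fin l → Option Bool} (h : Refines x y) (h' : Refines y z) :
    Refines x z := fun i v hi => h' i v (h i v hi)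

theorem refines_encode (b : Bool) (U x : Fin l → Option Bool) : Refines x (encode b U x) := by
  intro i v h
  simp [encode, h]

theorem refines_encode_of_not_falsifies {b : Bool} {U x : Fin l → Option Bool}
    (h : ¬ Falsifies U x) : Refines U (encode b U x) := by
  intro i v hU
  rcases hx : x i with _ | w
  · simp [encode, hx, hU]
  · by_cases hw : w = v
    · simp [encode, hx, hw]
    · exact absurd ⟨i, v, hU, by rw [hx]; congr; revert hw; cases w <;> cases v <;> simp⟩ h

theorem refines_of_not_live {U x : Fin l → Option Bool}
    (h : ¬ Falsifies U x) (h' : ¬ Live U x) : Refines U x := by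
  intro i v hU
  rcases hx : x i with _ | w
  · exact absurd ⟨i, by simp [hU], hx⟩ h'
  · by_cases hw : w = v
    · rw [hw]
    · exact absurd ⟨i, v, hU, by rw [hx]; congr; revert hw; cases w <;> cases v <;> simp⟩ h

/-- The configuration given by `α` on `B` and by `β` off `B`. -/
def glue (B : Finset A) {X : Type} (α : {a // a ∈ B} → X) (β : {a // a ∉ B} → X) : A → X :=
  (Equiv.piEquivPiSubtypeProd (· ∈ B) (fun _ => X)).symm (α, β)

omit [Fintype A] in
theorem glue_mem (B : Finset A) {X : Type} (α : {a // a ∈ B} → X) (β : {a // a ∉ B} → X)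
    {a : A} (h : a ∈ B) : glue B α β a = α ⟨a, h⟩ := by
  simp [glue, h]

omit [Fintype A] in
theorem glue_not_mem (B : Finset A) {X : Type} (α : {a // a ∈ B} → X) (β : {a // a ∉ B} → X)
    {a : A} (h : a ∉ B) : glue B α β a = β ⟨a, h⟩ := by
  simp [glue, h]

theorem sum_glue (B : Finset A) {X : Type} [Fintype X] (f : (A → X) → ℝ) :
    ∑ ρ, f ρ = ∑ α : {a // a ∈ B} → X, ∑ β : {a // a ∉ B} → X, f (glue B α β) := by
  rw [← Fintype.sum_prod_type' (f := fun α β => f (glue B α β))]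
  refine Fintype.sum_equiv (Equiv.piEquivPiSubtypeProd (· ∈ B) (fun _ => X)) _ _ fun ρ => ?_
  simp only [glue, Prod.mk.eta, Equiv.symm_apply_apply]

theorem prod_glue (B : Finset A) {X : Type} (μ : A → X → ℝ) (α : {a // a ∈ B} → X)
    (β : {a // a ∉ B} → X) :
    ∏ a, μ a (glue B α β a) = (∏ a : {a // a ∈ B}, μ a (α a)) * ∏ a : {a // a ∉ B}, μ a (β a) := by
  refine (Fintype.prod_subtype_mul_prod_subtype (fun a => a ∈ B)
    (fun a => μ a (glue B α β a))).symm.trans ?_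
  congr 1
  · exact Finset.prod_congr (by ext; simp) fun a _ => by rw [glue_mem B α β a.2]
  · exact Finset.prod_congr (by ext; simp) fun a _ => by rw [glue_not_mem B α β a.2]

/-- Answering the queries in `B` is modelled by giving these blocks point masses. The index set `A`
thus stays the same throughout the induction on the terms. -/
theorem sum_pointMass_glue (B : Finset A) {X : Type} [Fintype X] [DecidableEq X] (μ : A → X → ℝ)
    (α : {a // a ∈ B} → X) (f : (A → X) → ℝ) :
    ∑ ρ, (∏ a, if h : a ∈ B then (if ρ a = α ⟨a, h⟩ then (1 : ℝ) else 0) else μ a (ρ a)) * f ρ =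
      ∑ β : {a // a ∉ B} → X, (∏ a : {a // a ∉ B}, μ a (β a)) * f (glue B α β) := by
  rw [sum_glue B, Finset.sum_eq_single α]
  · refine Finset.sum_congr rfl fun β _ => ?_
    congr 1
    rw [prod_glue B (fun a x => if h : a ∈ B then (if x = α ⟨a, h⟩ then (1 : ℝ) else 0) else μ a x)]
    rw [Finset.prod_eq_one (fun a _ => by simp), one_mul]
    exact Finset.prod_congr rfl fun a _ => by rw [dif_neg a.2]
  · intro α' _ hne
    refine Finset.sum_eq_zero fun β _ => ?_
    obtain ⟨a, ha⟩ := Function.ne_iff.mp hne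
    rw [prod_glue B (fun a x => if h : a ∈ B then (if x = α ⟨a, h⟩ then (1 : ℝ) else 0) else μ a x)]
    rw [Finset.prod_eq_zero (Finset.mem_univ a) (by simp [ha]), zero_mul, zero_mul]
  · simp

/-- A product of encodings: the weight of the preimages. -/
theorem sum_encode_le {ι : Type} [Fintype ι] [DecidableEq ι] {b : Bool} {r : ℕ} {δ : ℝ}
    (μ : ι → (Fin l → Option Bool) → ℝ)
    (hμ : ∀ a, BlockGood b r δ (μ a)) (T : ι → Fin l → Option Bool)
    (hT : ∀ a, (Finset.univ.filter fun i => T a i ≠ none).card ≤ r)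
    (h : (ι → Fin l → Option Bool) → ℝ) (h0 : ∀ α, 0 ≤ h α) :
    ∑ α : ι → Fin l → Option Bool, (if ∀ a, ∃ i, α a i = none then
        (∏ a, μ a (α a)) * h (fun a => encode b (T a) (α a)) else 0) ≤
      δ ^ Fintype.card ι * ∑ α, (∏ a, μ a (α a)) * h α := by
  -- For a fixed image `y` the condition on `α` splits into one condition per block, so the weight
  -- of the preimages is a product.
  have key : ∀ y : ι → Fin l → Option Bool,
      ∑ α : ι → Fin l → Option Bool, (if (∀ a, ∃ i, α a i = none) ∧
        (fun a => encode b (T a) (α a)) = y then (∏ a, μ a (α a)) else 0) ≤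
      δ ^ Fintype.card ι * ∏ a, μ a (y a) := by
    intro y
    have h1 : ∀ α : ι → Fin l → Option Bool, (if (∀ a, ∃ i, α a i = none) ∧
        (fun a => encode b (T a) (α a)) = y then (∏ a, μ a (α a)) else 0) =
        ∏ a, (if (∃ i, α a i = none) ∧ encode b (T a) (α a) = y a then μ a (α a) else 0) := by
      intro α
      split_ifs with hc
      · refine Finset.prod_congr rfl fun a _ => ?_
        rw [if_pos ⟨hc.1 a, congrFun hc.2 a⟩]
      · have : ∃ a, ¬ ((∃ i, α a i = none) ∧ encode b (T a) (α a) = y a) := by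
          by_contra hcon
          push Not at hcon
          exact hc ⟨fun a => (hcon a).1, funext fun a => (hcon a).2⟩
        obtain ⟨a, ha⟩ := this
        rw [Finset.prod_eq_zero (Finset.mem_univ a)]
        rw [if_neg ha]
    rw [Finset.sum_congr rfl fun α _ => h1 α]
    have h2 := Finset.prod_univ_sum (fun _ : ι => (Finset.univ : Finset (Fin l → Option Bool)))
      (fun a x => if (∃ i, x i = none) ∧ encode b (T a) x = y a then μ a x else 0)
    rw [Fintype.piFinset_univ] at h2
    rw [← h2]
    calc _ ≤ ∏ a, δ * μ a (y a) := by
          refine Finset.prod_le_prod (fun a _ => Finset.sum_nonneg fun x _ => ?_) fun a _ => ?_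
          · split_ifs
            · exact (hμ a).1 x
            · exact le_rfl
          · exact (hμ a).2 (T a) (hT a) (y a)
      _ = _ := by rw [Finset.prod_mul_distrib, Finset.prod_const, Finset.card_univ]
  calc _ = ∑ α : ι → Fin l → Option Bool, ∑ y, (if (∀ a, ∃ i, α a i = none) ∧
        (fun a => encode b (T a) (α a)) = y then (∏ a, μ a (α a)) else 0) * h y := by
        refine Finset.sum_congr rfl fun α _ => ?_
        rw [Finset.sum_eq_single (fun a => encode b (T a) (α a))]
        · simp
        · intro y _ hy
          rw [if_neg (fun hc => hy hc.2.symm), zero_mul]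
        · simp
    _ = ∑ y, (∑ α : ι → Fin l → Option Bool, (if (∀ a, ∃ i, α a i = none) ∧
        (fun a => encode b (T a) (α a)) = y then (∏ a, μ a (α a)) else 0)) * h y := by
        rw [Finset.sum_comm]
        simp_rw [Finset.sum_mul]
    _ ≤ ∑ y, (δ ^ Fintype.card ι * ∏ a, μ a (y a)) * h y :=
        Finset.sum_le_sum fun y _ => mul_le_mul_of_nonneg_right (key y) (h0 y)
    _ = _ := by
        rw [Finset.mul_sum]
        exact Finset.sum_congr rfl fun y _ => by ring

/-- Changing the blocks in `B` to those of `α`. -/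
def overwrite (B : Finset A) {X : Type} (α : {a // a ∈ B} → X) (ρ : A → X) : A → X :=
  fun a => if h : a ∈ B then α ⟨a, h⟩ else ρ a

omit [Fintype A] in
theorem overwrite_glue (B : Finset A) {X : Type} (α α' : {a // a ∈ B} → X)
    (β : {a // a ∉ B} → X) : overwrite B α (glue B α' β) = glue B α β := by
  funext a
  by_cases h : a ∈ B
  · simp [overwrite, h, glue_mem]
  · simp [overwrite, h, glue_not_mem]

/-- An answered block has no free coordinate left, so the preimages to be bounded have weight zero.
-/
theorem blockGood_pointMass (b : Bool) (r : ℕ) {δ : ℝ} (hδ : 0 ≤ δ) (y : Fin l → Option Bool)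
    (hy : ∀ i, y i ≠ none) : BlockGood b r δ (fun x => if x = y then (1 : ℝ) else 0) := by
  have h0 : ∀ x, 0 ≤ if x = y then (1 : ℝ) else 0 := fun x => by split_ifs <;> norm_num
  refine ⟨h0, fun U _ z => ?_⟩
  rw [Finset.sum_eq_zero]
  · exact mul_nonneg hδ (h0 z)
  · intro x _
    by_cases h1 : x = y
    · rw [if_neg]
      rintro ⟨⟨i, hi⟩, -⟩
      exact hy i (h1 ▸ hi)
    · simp [h1]

/-- One round of the canonical decision tree: the blocks `B` are queried, with answers `P`. -/
theorem sum_bad_round {b : Bool} {r : ℕ} {δ ε : ℝ} (hδ : 0 ≤ δ)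
    (T : A → Fin l → Option Bool)
    (hT : ∀ a, (Finset.univ.filter fun i => T a i ≠ none).card ≤ r)
    (E : (A → Fin l → Option Bool) → Prop) (s : ℕ) (hε : 0 ≤ ε)
    (hE : ∀ μ : A → (Fin l → Option Bool) → ℝ, (∀ a, BlockGood b r δ (μ a)) →
      ∀ G : (A → Fin l → Option Bool) → ℝ, (∀ ρ, 0 ≤ G ρ) →
        (∀ ρ ρ', (∀ a, Refines (ρ a) (ρ' a)) → G ρ ≤ G ρ') →
        ∑ ρ, (∏ a, μ a (ρ a)) * (if E ρ then G ρ else 0) ≤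
          ε ^ s * ∑ ρ, (∏ a, μ a (ρ a)) * G ρ)
    (μ : A → (Fin l → Option Bool) → ℝ) (hμ : ∀ a, BlockGood b r δ (μ a))
    (G : (A → Fin l → Option Bool) → ℝ) (hG : ∀ ρ, 0 ≤ G ρ)
    (hGm : ∀ ρ ρ', (∀ a, Refines (ρ a) (ρ' a)) → G ρ ≤ G ρ') (B P : Finset A) :
    ∑ ρ, (∏ a, μ a (ρ a)) * (if (∀ a, ¬ Falsifies (T a) (ρ a)) ∧ liveSet T ρ = B ∧
        E (setOn B P ρ) then G ρ else 0) ≤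
      δ ^ B.card * ε ^ s *
        ∑ ρ, (∏ a, μ a (ρ a)) * (if ∀ a, Refines (T a) (ρ a) then G ρ else 0) := by
  -- Being satisfied by `ρ` is preserved by refinement, so `G₁` may serve as the weight function in
  -- the induction hypothesis.
  set G₁ : (A → Fin l → Option Bool) → ℝ :=
    fun ρ => if ∀ a, Refines (T a) (ρ a) then G ρ else 0 with hG₁
  have hG₁0 : ∀ ρ, 0 ≤ G₁ ρ := fun ρ => by
    simp only [hG₁]; split_ifs
    · exact hG ρ
    · exact le_rfl
  have hG₁m : ∀ ρ ρ', (∀ a, Refines (ρ a) (ρ' a)) → G₁ ρ ≤ G₁ ρ' := by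
    intro ρ ρ' h
    by_cases h1 : ∀ a, Refines (T a) (ρ a)
    · have h2 : ∀ a, Refines (T a) (ρ' a) := fun a => (h1 a).trans (h a)
      simp only [hG₁, if_pos h1, if_pos h2]
      exact hGm _ _ h
    · simp only [hG₁, if_neg h1]
      exact hG₁0 ρ'
  set enc : ({a // a ∈ B} → Fin l → Option Bool) → {a // a ∈ B} → Fin l → Option Bool :=
    fun α a => encode b (T a) (α a) with henc
  set ans : ({a // a ∈ B} → Fin l → Option Bool) → {a // a ∈ B} → Fin l → Option Bool :=
    fun α a => fill (decide (a.1 ∈ P)) (α a) with hans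
  have hprod0 : ∀ β : {a // a ∉ B} → Fin l → Option Bool,
      0 ≤ ∏ a : {a // a ∉ B}, μ a (β a) := fun β =>
    Finset.prod_nonneg fun a _ => (hμ a).1 _
  have hprod0' : ∀ α : {a // a ∈ B} → Fin l → Option Bool,
      0 ≤ ∏ a : {a // a ∈ B}, μ a (α a) := fun α =>
    Finset.prod_nonneg fun a _ => (hμ a).1 _
  -- the induction hypothesis, with the blocks of `B` fixed to the answers
  have hIH : ∀ α : {a // a ∈ B} → Fin l → Option Bool,
      ∑ β : {a // a ∉ B} → Fin l → Option Bool, (∏ a : {a // a ∉ B}, μ a (β a)) *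
        (if E (glue B (ans α) β) then G₁ (glue B (enc α) β) else 0) ≤
      ε ^ s * ∑ β : {a // a ∉ B} → Fin l → Option Bool, (∏ a : {a // a ∉ B}, μ a (β a)) *
        G₁ (glue B (enc α) β) := by
    intro α
    -- The blocks of `B` play two roles: the event `E` sees them filled with the answers, while the
    -- weight `G₁` sees them filled as `T` demands. Point masses provide the first filling and
    -- `overwrite` the second.
    have := hE (fun a x => if h : a ∈ B then (if x = ans α ⟨a, h⟩ then (1 : ℝ) else 0) else μ a x)
      ?_ (fun ρ => G₁ (overwrite B (enc α) ρ)) (fun ρ => hG₁0 _) ?_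
    · rw [sum_pointMass_glue B μ (ans α), sum_pointMass_glue B μ (ans α)] at this
      simpa only [overwrite_glue] using this
    · intro a
      by_cases h : a ∈ B
      · simp only [h, dite_true]
        exact blockGood_pointMass b r hδ _ fun i => by simp [hans, fill]
      · simp only [h, dite_false]
        exact hμ a
    · intro ρ ρ' hρ
      refine hG₁m _ _ fun a => ?_
      by_cases h : a ∈ B
      · simp only [overwrite, h, dite_true]
        exact Refines.refl _
      · simp only [overwrite, h, dite_false]
        exact hρ a
  calc _ = ∑ α : {a // a ∈ B} → Fin l → Option Bool, ∑ β : {a // a ∉ B} → Fin l → Option Bool,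
        ((∏ a : {a // a ∈ B}, μ a (α a)) * ∏ a : {a // a ∉ B}, μ a (β a)) *
        (if (∀ a, ¬ Falsifies (T a) (glue B α β a)) ∧ liveSet T (glue B α β) = B ∧
          E (setOn B P (glue B α β)) then G (glue B α β) else 0) := by
        rw [sum_glue B]
        simp_rw [prod_glue B μ]
    _ ≤ ∑ α : {a // a ∈ B} → Fin l → Option Bool, (if ∀ a, ∃ i, α a i = none then
        (∏ a : {a // a ∈ B}, μ a (α a)) *
          ∑ β : {a // a ∉ B} → Fin l → Option Bool, (∏ a : {a // a ∉ B}, μ a (β a)) *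
        (if E (glue B (ans α) β) then G₁ (glue B (enc α) β) else 0) else 0) := by
        refine Finset.sum_le_sum fun α _ => ?_
        -- If `T` is not falsified, then off `B` its literals are already satisfied, and on `B` the
        -- encoding satisfies them. The encoded restriction refines the original one, so `G` only
        -- grows.
        have hterm : ∀ β, (∀ a, ¬ Falsifies (T a) (glue B α β a)) ∧ liveSet T (glue B α β) = B ∧
            E (setOn B P (glue B α β)) →
            (∀ a, ∃ i, α a i = none) ∧ E (glue B (ans α) β) ∧
              G (glue B α β) ≤ G₁ (glue B (enc α) β) := by
          rintro β ⟨h1, h2, h3⟩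
          have hlive : ∀ a, Live (T a) (glue B α β a) ↔ a ∈ B := by
            intro a
            rw [← iff_of_eq (congrArg (a ∈ ·) h2)]; simp [liveSet]
          refine ⟨fun a => ?_, ?_, ?_⟩
          · obtain ⟨i, _, hi⟩ := (hlive a).2 a.2
            rw [glue_mem B α β a.2] at hi
            exact ⟨i, hi⟩
          · convert h3 using 1
            funext a
            by_cases h : a ∈ B
            · simp [setOn, h, glue_mem, hans]
            · simp [setOn, h, glue_not_mem]
          · have hsat : ∀ a, Refines (T a) (glue B (enc α) β a) := by
              intro a
              by_cases h : a ∈ B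
              · rw [glue_mem B _ _ h]
                refine refines_encode_of_not_falsifies ?_
                have := h1 a
                rwa [glue_mem B _ _ h] at this
              · rw [glue_not_mem B _ _ h]
                have h4 := h1 a
                have h5 := mt (hlive a).1 h
                rw [glue_not_mem B _ _ h] at h4 h5
                exact refines_of_not_live h4 h5
            simp only [hG₁, if_pos hsat]
            refine hGm _ _ fun a => ?_
            by_cases h : a ∈ B
            · rw [glue_mem B _ _ h, glue_mem B _ _ h]
              exact refines_encode _ _ _
            · rw [glue_not_mem B _ _ h, glue_not_mem B _ _ h]
              exact Refines.refl _
        split_ifs with hα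
        · rw [Finset.mul_sum]
          refine Finset.sum_le_sum fun β _ => ?_
          rw [mul_assoc]
          refine mul_le_mul_of_nonneg_left (mul_le_mul_of_nonneg_left ?_ (hprod0 β)) (hprod0' α)
          split_ifs with h1 h2 h2
          · exact (hterm β h1).2.2
          · exact absurd (hterm β h1).2.1 h2
          · exact hG₁0 _
          · exact le_rfl
        · refine le_of_eq (Finset.sum_eq_zero fun β _ => ?_)
          rw [if_neg fun h1 => hα (hterm β h1).1, mul_zero]
    _ ≤ ∑ α : {a // a ∈ B} → Fin l → Option Bool, (if ∀ a, ∃ i, α a i = none then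
        (∏ a : {a // a ∈ B}, μ a (α a)) * (ε ^ s *
          ∑ β : {a // a ∉ B} → Fin l → Option Bool, (∏ a : {a // a ∉ B}, μ a (β a)) *
            G₁ (glue B (enc α) β)) else 0) := by
        refine Finset.sum_le_sum fun α _ => ?_
        split_ifs
        · exact mul_le_mul_of_nonneg_left (hIH α) (hprod0' α)
        · exact le_rfl
    _ ≤ δ ^ Fintype.card {a // a ∈ B} * ∑ α : {a // a ∈ B} → Fin l → Option Bool,
        (∏ a : {a // a ∈ B}, μ a (α a)) * (ε ^ s *
          ∑ β : {a // a ∉ B} → Fin l → Option Bool, (∏ a : {a // a ∉ B}, μ a (β a)) *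
            G₁ (glue B α β)) :=
        sum_encode_le (fun a : {a // a ∈ B} => μ a) (fun a => hμ a) (fun a => T a)
          (fun a => hT a) (fun α => ε ^ s *
          ∑ β : {a // a ∉ B} → Fin l → Option Bool, (∏ a : {a // a ∉ B}, μ a (β a)) *
            G₁ (glue B α β)) fun α => mul_nonneg (pow_nonneg hε _)
              (Finset.sum_nonneg fun β _ => mul_nonneg (hprod0 β) (hG₁0 _))
    _ = _ := by
        rw [Fintype.card_coe, mul_assoc]
        congr 1
        rw [sum_glue B (fun ρ => (∏ a, μ a (ρ a)) * G₁ ρ), Finset.mul_sum]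
        refine Finset.sum_congr rfl fun α _ => ?_
        simp_rw [prod_glue B μ, mul_assoc]
        rw [← Finset.mul_sum]
        ring

omit [Fintype A] [DecidableEq A] in
/-- The sum over the nonempty sets of queried blocks and the answers. -/
theorem sum_rounds_le {r : ℕ} {δ ε : ℝ} (hδ : 0 ≤ δ) (hε : 0 < ε) (hε1 : ε ≤ 1)
    (h : (1 + 2 * δ / ε) ^ r ≤ 2) (U : Finset A) (hU : U.card ≤ r) (s : ℕ) :
    ∑ B ∈ U.powerset.filter (fun B => B.Nonempty), ∑ _P ∈ B.powerset,
      δ ^ B.card * ε ^ (s - B.card) ≤ ε ^ s := by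
  have h1 : ∀ B ∈ U.powerset.filter (fun B => B.Nonempty), ∑ _P ∈ B.powerset,
      δ ^ B.card * ε ^ (s - B.card) ≤ ε ^ s * (2 * δ / ε) ^ B.card := by
    intro B _
    rw [Finset.sum_const, Finset.card_powerset, nsmul_eq_mul]
    -- The subtraction is truncated; `ε ≤ 1` covers the case of more than `s` queried blocks.
    have h2 : ε ^ (s - B.card) ≤ ε ^ s / ε ^ B.card := by
      rw [le_div_iff₀ (pow_pos hε _), ← pow_add]
      exact pow_le_pow_of_le_one hε.le hε1 (by omega)
    calc ((2 ^ B.card : ℕ) : ℝ) * (δ ^ B.card * ε ^ (s - B.card))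
        ≤ ((2 ^ B.card : ℕ) : ℝ) * (δ ^ B.card * (ε ^ s / ε ^ B.card)) := by gcongr
      _ = ε ^ s * (2 * δ / ε) ^ B.card := by
        rw [div_pow, mul_pow]; push_cast; ring
  refine (Finset.sum_le_sum h1).trans ?_
  rw [← Finset.mul_sum]
  refine mul_le_of_le_one_right (pow_nonneg hε.le _) ?_
  have h3 : ∑ B ∈ U.powerset, (2 * δ / ε) ^ B.card = (1 + 2 * δ / ε) ^ U.card := by
    rw [add_comm, ← Finset.sum_pow_mul_eq_add_pow]
    simp
  -- The empty set contributes exactly 1 to the binomial sum. Leaving it out turns the bound 2 of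
  -- the hypothesis into 1.
  have h4 : ∑ B ∈ U.powerset.filter (fun B => B.Nonempty), (2 * δ / ε) ^ B.card + 1 =
      ∑ B ∈ U.powerset, (2 * δ / ε) ^ B.card := by
    rw [← Finset.sum_filter_add_sum_filter_not U.powerset (fun B => B.Nonempty)]
    congr 1
    have : U.powerset.filter (fun B => ¬ B.Nonempty) = {∅} := by
      ext B; simp only [Finset.mem_filter, Finset.mem_powerset, Finset.not_nonempty_iff_eq_empty,
        Finset.mem_singleton]
      exact ⟨fun h => h.2, fun h => ⟨by simp [h], h⟩⟩
    rw [this]; simp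
  have h5 : (1 + 2 * δ / ε) ^ U.card ≤ (1 + 2 * δ / ε) ^ r :=
    pow_le_pow_right₀ (by have : 0 ≤ 2 * δ / ε := by positivity
                          linarith) hU
  linarith

/-- The switching lemma: under a product of good block weights, and conditioned on any event that
is preserved by refinement, the canonical tree is deep with small probability. -/
theorem sum_bad_le {b : Bool} {r : ℕ} {δ ε : ℝ} (hδ : 0 ≤ δ) (hε : 0 < ε) (hε1 : ε ≤ 1)
    (h : (1 + 2 * δ / ε) ^ r ≤ 2) (F : List (A → Fin l → Option Bool))
    (hF : ∀ T ∈ F, (touched T).card ≤ r ∧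
      ∀ a, (Finset.univ.filter fun i => T a i ≠ none).card ≤ r) :
    ∀ (s : ℕ) (μ : A → (Fin l → Option Bool) → ℝ), (∀ a, BlockGood b r δ (μ a)) →
      ∀ G : (A → Fin l → Option Bool) → ℝ, (∀ ρ, 0 ≤ G ρ) →
        (∀ ρ ρ', (∀ a, Refines (ρ a) (ρ' a)) → G ρ ≤ G ρ') →
        ∑ ρ, (∏ a, μ a (ρ a)) * (if Bad F s ρ then G ρ else 0) ≤
          ε ^ s * ∑ ρ, (∏ a, μ a (ρ a)) * G ρ := by
  induction F with
  | nil =>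
    intro s μ hμ G hG _
    by_cases hs : s = 0
    · simp [Bad, hs]
    · simp only [Bad, hs, if_false, mul_zero, Finset.sum_const_zero]
      exact mul_nonneg (pow_nonneg hε.le _) (Finset.sum_nonneg fun ρ _ =>
        mul_nonneg (Finset.prod_nonneg fun a _ => (hμ a).1 _) (hG ρ))
  | cons T F ih =>
    intro s μ hμ G hG hGm
    have hTF := hF T (by simp)
    have ih' := ih fun T' hT' => hF T' (List.mem_cons_of_mem _ hT')
    by_cases hs : s = 0
    · subst hs
      simp [Bad_zero]
    have hprod0 : ∀ ρ : A → Fin l → Option Bool, 0 ≤ ∏ a, μ a (ρ a) := fun ρ =>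
      Finset.prod_nonneg fun a _ => (hμ a).1 _
    set G₀ : (A → Fin l → Option Bool) → ℝ :=
      fun ρ => if ∃ a, Falsifies (T a) (ρ a) then G ρ else 0 with hG₀
    set G₁ : (A → Fin l → Option Bool) → ℝ :=
      fun ρ => if ∀ a, Refines (T a) (ρ a) then G ρ else 0 with hG₁
    have hG₀0 : ∀ ρ, 0 ≤ G₀ ρ := fun ρ => by
      simp only [hG₀]; split_ifs
      · exact hG ρ
      · exact le_rfl
    have hG₁0 : ∀ ρ, 0 ≤ G₁ ρ := fun ρ => by
      simp only [hG₁]; split_ifs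
      · exact hG ρ
      · exact le_rfl
    have hG₀m : ∀ ρ ρ', (∀ a, Refines (ρ a) (ρ' a)) → G₀ ρ ≤ G₀ ρ' := by
      intro ρ ρ' hρ
      by_cases h1 : ∃ a, Falsifies (T a) (ρ a)
      · have h2 : ∃ a, Falsifies (T a) (ρ' a) := h1.imp fun a ha => (hρ a).falsifies ha
        simp only [hG₀, if_pos h1, if_pos h2]
        exact hGm _ _ hρ
      · simp only [hG₀, if_neg h1]
        exact hG₀0 ρ'
    -- No restriction both falsifies and satisfies `T`; this disjointness is why the two cases
    -- together do not exceed `ε ^ s`.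
    have hsplit : ∀ ρ, G₀ ρ + G₁ ρ ≤ G ρ := by
      intro ρ
      by_cases h1 : ∃ a, Falsifies (T a) (ρ a)
      · have h2 : ¬ ∀ a, Refines (T a) (ρ a) := by
          obtain ⟨a, i, v, hU, hx⟩ := h1
          intro h2
          have := h2 a i v hU
          rw [hx] at this
          simp at this
        simp [hG₀, hG₁, if_pos h1, if_neg h2]
      · simp only [hG₀, hG₁, if_neg h1, zero_add]
        split_ifs
        · exact le_rfl
        · exact hG ρ
    set Q := (touched T).powerset.filter (fun B => B.Nonempty) with hQ
    have hpt : ∀ ρ, (if Bad (T :: F) s ρ then G ρ else 0) ≤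
        (if Bad F s ρ then G₀ ρ else 0) + ∑ B ∈ Q, ∑ P ∈ B.powerset,
          (if (∀ a, ¬ Falsifies (T a) (ρ a)) ∧ liveSet T ρ = B ∧
            Bad F (s - B.card) (setOn B P ρ) then G ρ else 0) := by
      intro ρ
      have hnn : ∀ B P, 0 ≤ (if (∀ a, ¬ Falsifies (T a) (ρ a)) ∧ liveSet T ρ = B ∧
            Bad F (s - B.card) (setOn B P ρ) then G ρ else 0) := by
        intro B P; split_ifs
        · exact hG ρ
        · exact le_rfl
      have hnn0 : 0 ≤ (if Bad F s ρ then G₀ ρ else 0) := by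
        split_ifs
        · exact hG₀0 ρ
        · exact le_rfl
      have hnn1 := Finset.sum_nonneg fun B (_ : B ∈ Q) =>
        Finset.sum_nonneg fun P (_ : P ∈ B.powerset) => hnn B P
      by_cases hbad : Bad (T :: F) s ρ
      · rw [if_pos hbad]
        rcases hbad with h0 | ⟨hf, hb⟩ | ⟨hf, hne, P, hP, hb⟩
        · exact absurd h0 hs
        · rw [if_pos hb]
          simp only [hG₀, if_pos hf]
          linarith
        · have hmem : liveSet T ρ ∈ Q := by
            simp only [hQ, Finset.mem_filter, Finset.mem_powerset]
            refine ⟨fun a ha => ?_, hne⟩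
            simp only [liveSet, touched, Finset.mem_filter, Finset.mem_univ, true_and] at ha ⊢
            exact ha.imp fun i hi => hi.1
          have h1 := Finset.single_le_sum (f := fun B => ∑ P ∈ B.powerset,
            (if (∀ a, ¬ Falsifies (T a) (ρ a)) ∧ liveSet T ρ = B ∧
              Bad F (s - B.card) (setOn B P ρ) then G ρ else 0))
            (fun B _ => Finset.sum_nonneg fun P _ => hnn B P) hmem
          have h2 := Finset.single_le_sum (f := fun P =>
            (if (∀ a, ¬ Falsifies (T a) (ρ a)) ∧ liveSet T ρ = liveSet T ρ ∧
              Bad F (s - (liveSet T ρ).card) (setOn (liveSet T ρ) P ρ) then G ρ else 0))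
            (fun P _ => hnn (liveSet T ρ) P) (Finset.mem_powerset.2 hP)
          have h3 : (if (∀ a, ¬ Falsifies (T a) (ρ a)) ∧ liveSet T ρ = liveSet T ρ ∧
              Bad F (s - (liveSet T ρ).card) (setOn (liveSet T ρ) P ρ) then G ρ else 0) = G ρ :=
            if_pos ⟨hf, rfl, hb⟩
          linarith [(h3.symm.le.trans h2).trans h1]
      · rw [if_neg hbad]
        linarith
    calc _ ≤ ∑ ρ, (∏ a, μ a (ρ a)) * ((if Bad F s ρ then G₀ ρ else 0) +
          ∑ B ∈ Q, ∑ P ∈ B.powerset,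
          (if (∀ a, ¬ Falsifies (T a) (ρ a)) ∧ liveSet T ρ = B ∧
            Bad F (s - B.card) (setOn B P ρ) then G ρ else 0)) :=
          Finset.sum_le_sum fun ρ _ => mul_le_mul_of_nonneg_left (hpt ρ) (hprod0 ρ)
      _ = ∑ ρ, (∏ a, μ a (ρ a)) * (if Bad F s ρ then G₀ ρ else 0) +
          ∑ B ∈ Q, ∑ P ∈ B.powerset, ∑ ρ, (∏ a, μ a (ρ a)) *
          (if (∀ a, ¬ Falsifies (T a) (ρ a)) ∧ liveSet T ρ = B ∧
            Bad F (s - B.card) (setOn B P ρ) then G ρ else 0) := by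
          simp_rw [mul_add, Finset.sum_add_distrib, Finset.mul_sum]
          congr 1
          rw [Finset.sum_comm]
          exact Finset.sum_congr rfl fun B _ => Finset.sum_comm
      _ ≤ ε ^ s * ∑ ρ, (∏ a, μ a (ρ a)) * G₀ ρ +
          ∑ B ∈ Q, ∑ P ∈ B.powerset, δ ^ B.card * ε ^ (s - B.card) *
            ∑ ρ, (∏ a, μ a (ρ a)) * G₁ ρ := by
          refine add_le_add (ih' s μ hμ G₀ hG₀0 hG₀m) ?_
          refine Finset.sum_le_sum fun B _ => Finset.sum_le_sum fun P _ => ?_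
          exact sum_bad_round hδ T hTF.2 (Bad F (s - B.card)) (s - B.card) hε.le
            (ih' (s - B.card)) μ hμ G hG hGm B P
      _ ≤ ε ^ s * ∑ ρ, (∏ a, μ a (ρ a)) * G₀ ρ + ε ^ s * ∑ ρ, (∏ a, μ a (ρ a)) * G₁ ρ := by
          have h1 := mul_le_mul_of_nonneg_right (sum_rounds_le hδ hε hε1 h _ hTF.1 s)
            (Finset.sum_nonneg fun ρ (_ : ρ ∈ Finset.univ) => mul_nonneg (hprod0 ρ) (hG₁0 ρ))
          simp_rw [Finset.sum_mul _ _ (∑ ρ, (∏ a, μ a (ρ a)) * G₁ ρ)] at h1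
          linarith
      _ = ε ^ s * ∑ ρ, (∏ a, μ a (ρ a)) * (G₀ ρ + G₁ ρ) := by
          rw [← mul_add, ← Finset.sum_add_distrib]
          simp_rw [mul_add]
      _ ≤ _ := by
          refine mul_le_mul_of_nonneg_left (Finset.sum_le_sum fun ρ _ => ?_) (pow_nonneg hε.le _)
          exact mul_le_mul_of_nonneg_left (hsplit ρ) (hprod0 ρ)

end Core

/-! ### Decision trees, certificates, and the switching lemma for projections. -/

section Trees

open Classical

/-- `f` is computed by a decision tree of depth at most `s`. -/
def HasTree {V : Type} (f : BoolFun V) (s : ℕ) : Prop :=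
  ∃ T : DTree V, T.depth ≤ s ∧ ∀ x, T.eval x = f x

theorem hasTree_const {V : Type} (b : Bool) (s : ℕ) : HasTree (fun _ : V → Bool => b) s :=
  ⟨.leaf b, Nat.zero_le _, fun _ => rfl⟩

theorem HasTree.not {V : Type} {f : BoolFun V} {s : ℕ} (h : HasTree f s) :
    HasTree (fun x => !(f x)) s := by
  obtain ⟨T, hT, hf⟩ := h
  suffices ∃ T' : DTree V, T'.depth ≤ T.depth ∧ ∀ x, T'.eval x = !(T.eval x) by
    obtain ⟨T', h1, h2⟩ := this
    exact ⟨T', h1.trans hT, fun x => by rw [h2, hf]⟩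
  clear hT hf
  induction T with
  | leaf b => exact ⟨.leaf (!b), le_rfl, fun _ => rfl⟩
  | node v T₀ T₁ h0 h1 =>
    obtain ⟨S₀, h0, h0'⟩ := h0
    obtain ⟨S₁, h1, h1'⟩ := h1
    refine ⟨.node v S₀ S₁, Nat.succ_le_succ (max_le_max h0 h1), fun x => ?_⟩
    simp only [DTree.eval]
    split_ifs
    · exact h1' x
    · exact h0' x

/-- All variables of `B` are queried one after another; `P` is the set of those answered 1. -/
theorem hasTree_query {V : Type} [DecidableEq V] (B : Finset V) (k : ℕ) :
    ∀ f : BoolFun V,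
      (∀ P ⊆ B, HasTree (fun y => f fun a => if a ∈ B then decide (a ∈ P) else y a) k) →
      HasTree f (B.card + k) := by
  induction B using Finset.induction_on with
  | empty =>
    intro f h
    simpa using h ∅ le_rfl
  | insert a B ha ih =>
    intro f h
    have key : ∀ b : Bool, HasTree (fun y => f (Function.update y a b)) (B.card + k) := by
      intro b
      refine ih _ fun P hP => ?_
      have := h (if b then insert a P else P) (by
        split_ifs
        · exact Finset.insert_subset_insert a hP
        · exact hP.trans (Finset.subset_insert a B))
      convert this using 3
      rename_i y
      funext c
      by_cases hc : c = a
      · subst hc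
        have hcP : c ∉ P := fun h => ha (hP h)
        cases b
        · simpa using hcP
        · simp
      · cases b <;> simp [hc]
    obtain ⟨T₀, h0, h0'⟩ := key false
    obtain ⟨T₁, h1, h1'⟩ := key true
    refine ⟨.node a T₀ T₁, ?_, fun x => ?_⟩
    · rw [Finset.card_insert_of_notMem ha]
      simp only [DTree.depth]
      omega
    · simp only [DTree.eval, h0', h1']
      split_ifs with hx
      · rw [← hx, Function.update_eq_self]
      · rw [← (Bool.not_eq_true _ ▸ hx : x a = false), Function.update_eq_self]

/-- If the canonical decision tree is shallow, then the projection of the DNF has a shallow tree. -/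
theorem hasTree_of_not_bad {A : Type} [Fintype A] [DecidableEq A] {l : ℕ}
    (F : List (A → Fin l → Option Bool)) :
    ∀ (s : ℕ) (ρ : A → Fin l → Option Bool), ¬ Bad F (s + 1) ρ →
      HasTree (fun y : A → Bool => decide (∃ T ∈ F, ∀ a, Refines (T a) (fill (y a) (ρ a)))) s := by
  induction F with
  | nil =>
    intro s ρ _
    simpa using hasTree_const false s
  | cons T F ih =>
    intro s ρ hb
    simp only [Bad, not_or, not_and, not_exists] at hb
    obtain ⟨-, hb1, hb2⟩ := hb
    have hfill : ∀ (b : Bool) (x : Fin l → Option Bool), Refines x (fill b x) := by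
      intro b x i v h
      simp [fill, h]
    have hfals : ∀ (U x : Fin l → Option Bool), Falsifies U x → ¬ Refines U x := by
      rintro U x ⟨i, v, hU, hx⟩ h
      have := h i v hU
      rw [hx] at this
      simp at this
    by_cases hf : ∃ a, Falsifies (T a) (ρ a)
    · obtain ⟨a, ha⟩ := hf
      have h1 : ∀ y : A → Bool, ¬ ∀ a, Refines (T a) (fill (y a) (ρ a)) := fun y h =>
        hfals _ _ ((hfill (y a) (ρ a)).falsifies ha) (h a)
      simpa [h1] using ih s ρ (hb1 ⟨a, ha⟩)
    · push Not at hf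
      by_cases hB : (liveSet T ρ).Nonempty
      · have hb3 := hb2 hf hB
        set B := liveSet T ρ with hBdef
        -- With more than `s` live blocks the truncated subtraction would leave the demand 0, which
        -- `Bad` always meets.
        have hcard : B.card ≤ s := by
          by_contra hcon
          refine hb3 ∅ (Finset.empty_subset _) ?_
          rw [show s + 1 - B.card = 0 by omega]
          exact Bad_zero _ _
        have := hasTree_query B (s - B.card)
          (fun y : A → Bool => decide (∃ T' ∈ T :: F, ∀ a, Refines (T' a) (fill (y a) (ρ a))))
        rw [Nat.add_sub_cancel' hcard] at this
        refine this fun P hP => ?_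
        -- All free coordinates of a block are replaced by the same variable `y a`, so a single
        -- query settles the whole block.
        have hset : ∀ (y : A → Bool) a,
            fill (if a ∈ B then decide (a ∈ P) else y a) (ρ a) = fill (y a) (setOn B P ρ a) := by
          intro y a
          by_cases h : a ∈ B
          · funext i; simp [setOn, h, fill]
          · simp [setOn, h]
        simp only [hset]
        have hout : ∀ a, a ∉ B → Refines (T a) (ρ a) := fun a ha =>
          refines_of_not_live (hf a) (by simpa [hBdef, liveSet] using ha)
        have hT : ∀ y y' : A → Bool, (∀ a, Refines (T a) (fill (y a) (setOn B P ρ a))) →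
            ∀ a, Refines (T a) (fill (y' a) (setOn B P ρ a)) := by
          intro y y' h a
          by_cases ha : a ∈ B
          · have := h a
            rw [← hset] at this ⊢
            simpa only [ha, if_true] using this
          · rw [← hset]
            exact (hout a ha).trans (hfill _ _)
        -- After the answers the value of `T` no longer depends on `y`. If `T` holds the tree stops;
        -- otherwise the later terms decide. `Bad` continues with `F` in both cases, so it can only
        -- overestimate the depth.
        by_cases hs : ∃ y : A → Bool, ∀ a, Refines (T a) (fill (y a) (setOn B P ρ a))
        · obtain ⟨y, hy⟩ := hs
          convert hasTree_const true (s - B.card) using 2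
          rename_i y'
          simp only [decide_eq_true_eq]
          exact ⟨T, by simp, hT y y' hy⟩
        · push Not at hs
          have hs' : ∀ y : A → Bool, ¬ ∀ a, Refines (T a) (fill (y a) (setOn B P ρ a)) := by
            intro y h
            obtain ⟨a, ha⟩ := hs y
            exact ha (h a)
          have := ih (s - B.card) (setOn B P ρ) (by
            rw [show s - B.card + 1 = s + 1 - B.card by omega]
            exact hb3 P hP)
          simpa [hs'] using this
      · rw [Finset.not_nonempty_iff_eq_empty] at hB
        have h1 : ∀ a, Refines (T a) (ρ a) := fun a => refines_of_not_live (hf a) fun h => by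
          have : a ∈ liveSet T ρ := by simp [liveSet, h]
          simp [hB] at this
        convert hasTree_const true s using 2
        simp only [decide_eq_true_eq]
        exact ⟨T, by simp, fun a => (h1 a).trans (hfill _ _)⟩

/-- Every input accepted by `f` has a certificate that mentions at most `r` variables. -/
def Cert {V : Type} [Fintype V] (r : ℕ) (f : BoolFun V) : Prop :=
  ∀ x, f x = true → ∃ T : Restr V, (Finset.univ.filter fun v => T v ≠ none).card ≤ r ∧
    (∀ v b, T v = some b → x v = b) ∧ ∀ y, (∀ v b, T v = some b → y v = b) → f y = true

/-- The certificate of `x` is the path that `x` follows. -/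
theorem HasTree.cert {V : Type} [Fintype V] {f : BoolFun V} {s : ℕ} (h : HasTree f s) :
    Cert s f := by
  obtain ⟨T, hT, hf⟩ := h
  suffices ∀ (T : DTree V), Cert T.depth T.eval by
    intro x hx
    rw [← hf] at hx
    obtain ⟨U, h1, h2, h3⟩ := this T x hx
    exact ⟨U, h1.trans hT, h2, fun y hy => by rw [← hf]; exact h3 y hy⟩
  clear hT hf
  intro T
  induction T with
  | leaf b =>
    intro x hx
    exact ⟨fun _ => none, by simp, by simp, fun _ _ => hx⟩
  | node v T₀ T₁ h0 h1 =>
    intro x hx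
    have key : ∀ (b : Bool) (S : DTree V), x v = b → S.depth ≤ max T₀.depth T₁.depth →
        Cert S.depth S.eval → S.eval x = true →
        (∀ y : V → Bool, y v = b → (DTree.node v T₀ T₁).eval y = S.eval y) →
        ∃ T : Restr V, (Finset.univ.filter fun v => T v ≠ none).card ≤ (DTree.node v T₀ T₁).depth ∧
          (∀ v b, T v = some b → x v = b) ∧
          ∀ y, (∀ v b, T v = some b → y v = b) → (DTree.node v T₀ T₁).eval y = true := by
      intro b S hxv hd hS hSx hS'
      obtain ⟨U, h1, h2, h3⟩ := hS x hSx
      refine ⟨Function.update U v (some b), ?_, ?_, ?_⟩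
      · have hsub : (Finset.univ.filter fun u => Function.update U v (some b) u ≠ none) ⊆
            insert v (Finset.univ.filter fun u => U u ≠ none) := by
          intro u hu
          by_cases huv : u = v
          · simp [huv]
          · simpa [huv] using hu
        refine (Finset.card_le_card hsub).trans ((Finset.card_insert_le _ _).trans ?_)
        simp only [DTree.depth]
        omega
      · intro u c hu
        by_cases huv : u = v
        · subst huv; simp at hu; rw [hxv, hu]
        · exact h2 u c (by simpa [huv] using hu)
      · intro y hy
        have hyv : y v = b := hy v b (by simp)
        rw [hS' y hyv]
        refine h3 y fun u c hu => ?_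
        by_cases huv : u = v
        · subst huv; rw [hyv, ← hxv]; exact h2 u c hu
        · exact hy u c (by simpa [huv] using hu)
    rcases hxv : x v with _ | _
    · exact key false T₀ hxv (le_max_left _ _) h0 (by simpa [DTree.eval, hxv] using hx)
        fun y hy => by simp [DTree.eval, hy]
    · exact key true T₁ hxv (le_max_right _ _) h1 (by simpa [DTree.eval, hxv] using hx)
        fun y hy => by simp [DTree.eval, hy]

theorem Cert.mono {V : Type} [Fintype V] {f : BoolFun V} {r s : ℕ} (h : Cert r f) (hrs : r ≤ s) :
    Cert s f := fun x hx => by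
  obtain ⟨T, h1, h2⟩ := h x hx
  exact ⟨T, h1.trans hrs, h2⟩

variable {A : Type} [Fintype A] [DecidableEq A] {l : ℕ}

/-- The projection switching lemma for functions with small certificates. -/
theorem sum_not_hasTree_proj_le {b : Bool} {r : ℕ} {δ ε : ℝ} (hδ : 0 ≤ δ) (hε : 0 < ε)
    (hε1 : ε ≤ 1) (h : (1 + 2 * δ / ε) ^ r ≤ 2) {f : BoolFun (A × Fin l)} (hf : Cert r f)
    (μ : A → (Fin l → Option Bool) → ℝ) (hμ : ∀ a, BlockGood b r δ (μ a)) (s : ℕ) :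
    ∑ ρ : Restr (A × Fin l), (if ¬ HasTree (proj ρ f) s then
        ∏ a, μ a (fun i => ρ (a, i)) else 0) ≤
      ε ^ (s + 1) * ∑ ρ : Restr (A × Fin l), ∏ a, μ a (fun i => ρ (a, i)) := by
  -- The DNF consists of all implicants on at most `r` variables; `Cert` says exactly that these
  -- cover `f`. The number of terms does not enter the switching bound.
  set F : List (A → Fin l → Option Bool) :=
    (Finset.univ.filter fun T : A → Fin l → Option Bool =>
      (Finset.univ.filter fun v : A × Fin l => T v.1 v.2 ≠ none).card ≤ r ∧
      ∀ y : A × Fin l → Bool, (∀ a i c, T a i = some c → y (a, i) = c) → f y = true).toList with hF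
  have hmem : ∀ T, T ∈ F ↔ (Finset.univ.filter fun v : A × Fin l => T v.1 v.2 ≠ none).card ≤ r ∧
      ∀ y : A × Fin l → Bool, (∀ a i c, T a i = some c → y (a, i) = c) → f y = true := by
    intro T; simp [hF]
  have hproj : ∀ ρ : Restr (A × Fin l), proj ρ f = fun y : A → Bool =>
      decide (∃ T ∈ F, ∀ a, Refines (T a) (fill (y a) (fun i => ρ (a, i)))) := by
    intro ρ
    funext y
    rw [Bool.eq_iff_iff, decide_eq_true_iff]
    simp only [proj]
    constructor
    · intro hx
      obtain ⟨T, h1, h2, h3⟩ := hf _ hx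
      refine ⟨fun a i => T (a, i), (hmem _).2 ⟨h1, fun y hy => h3 y fun v c hv => hy v.1 v.2 c hv⟩,
        fun a i c hc => ?_⟩
      have := h2 (a, i) c hc
      simp only at this
      simp [fill, this]
    · rintro ⟨T, hT, hr⟩
      refine ((hmem T).1 hT).2 _ fun a i c hc => ?_
      have := hr a i c hc
      simpa [fill] using this
  have hwidth : ∀ T ∈ F, (touched T).card ≤ r ∧
      ∀ a, (Finset.univ.filter fun i => T a i ≠ none).card ≤ r := by
    intro T hT
    have h1 := ((hmem T).1 hT).1
    refine ⟨le_trans ?_ h1, fun a => le_trans ?_ h1⟩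
    · refine (Finset.card_le_card (t := (Finset.univ.filter fun v : A × Fin l =>
        T v.1 v.2 ≠ none).image Prod.fst) fun a ha => ?_).trans Finset.card_image_le
      simp only [touched, Finset.mem_filter, Finset.mem_univ, true_and] at ha
      obtain ⟨i, hi⟩ := ha
      exact Finset.mem_image.2 ⟨(a, i), by simp [hi], rfl⟩
    · refine Finset.card_le_card_of_injOn (fun i => (a, i)) (fun i hi => ?_) fun i _ i' _ hii => ?_
      · simpa using hi
      · simpa using hii
  have hmain := sum_bad_le hδ hε hε1 h F hwidth (s + 1) μ hμ (fun _ => 1)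
    (fun _ => zero_le_one) fun _ _ _ => le_rfl
  have e1 : ∀ g : (A → Fin l → Option Bool) → ℝ,
      ∑ ρ : Restr (A × Fin l), g (fun a i => ρ (a, i)) = ∑ ρ, g ρ := fun g =>
    Fintype.sum_equiv (Equiv.curry A (Fin l) (Option Bool)) _ _ fun ρ => rfl
  rw [e1 (fun ρ => ∏ a, μ a (ρ a))]
  simp only [mul_one] at hmain
  refine le_trans ?_ hmain
  rw [← e1]
  refine Finset.sum_le_sum fun ρ _ => ?_
  have h0 : 0 ≤ ∏ a, μ a (fun i => ρ (a, i)) := Finset.prod_nonneg fun a _ => (hμ a).1 _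
  by_cases hb : Bad F (s + 1) (fun a i => ρ (a, i))
  · rw [if_pos hb, mul_one]
    split_ifs
    · exact h0
    · exact le_rfl
  · have := hasTree_of_not_bad F s _ hb
    rw [← hproj ρ] at this
    simp [this, hb]

end Trees

/-! ### The block distributions satisfy `BlockGood`. -/

section Blocks

open Classical

variable {l : ℕ}

theorem sum_prod_coord {ι κ : Type} [Fintype ι] [DecidableEq ι] [Fintype κ] (f : ι → κ → ℝ) :
    ∑ x : ι → κ, ∏ i, f i (x i) = ∏ i, ∑ b, f i b := by
  have := Finset.prod_univ_sum (fun _ : ι => (Finset.univ : Finset κ)) f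
  rw [Fintype.piFinset_univ] at this
  exact this.symm

theorem sum_prodWeight {x : Option Bool} {c : Bool} (hx : x ≠ some c) (t : ℝ)
    (τ : Fin l → Option Bool) : ∑ σ, prodWeight x c t τ σ = 1 := by
  unfold prodWeight
  rw [sum_prod_coord (fun i b => if τ i = none then (if b = x then t else if b = some c then 1 - t
    else 0) else if b = τ i then (1 : ℝ) else 0)]
  refine Finset.prod_eq_one fun i _ => ?_
  by_cases h : τ i = none
  · simp only [h, if_true]
    rcases x with _ | _ | _ <;> rcases c with _ | _ <;> simp_all [Fintype.sum_option]
  · simp [h]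

theorem prodWeight_nonneg (x : Option Bool) (c : Bool) {t : ℝ} (h0 : 0 ≤ t) (h1 : t ≤ 1)
    (τ σ : Fin l → Option Bool) : 0 ≤ prodWeight x c t τ σ := by
  refine Finset.prod_nonneg fun i _ => ?_
  split_ifs <;> linarith

theorem prodWeight_eq_zero_of_free {b c : Bool} (t : ℝ) (τ : Fin l → Option Bool)
    {σ : Fin l → Option Bool} (h : ∃ i, σ i = none) : prodWeight (some b) c t τ σ = 0 := by
  obtain ⟨i, hi⟩ := h
  refine Finset.prod_eq_zero (Finset.mem_univ i) ?_
  by_cases h : τ i = none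
  · simp [h, hi]
  · simp [h, hi, Ne.symm h]

theorem prodWeight_fill {x : Option Bool} {c : Bool} (hx : x ≠ some c) (t : ℝ)
    (τ : Fin l → Option Bool) : prodWeight x c t τ (fill c τ) = (1 - t) ^ stars τ := by
  have : ∀ i, (if τ i = none then (if fill c τ i = x then t else if fill c τ i = some c then 1 - t
      else 0) else if fill c τ i = τ i then (1 : ℝ) else 0) = if τ i = none then 1 - t else 1 := by
    intro i
    rcases h : τ i with _ | v
    · simp [fill, h, Ne.symm hx]
    · simp [fill, h]
  unfold prodWeight stars
  rw [Finset.prod_congr rfl fun i _ => this i, Finset.prod_ite, Finset.prod_const,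
    Finset.prod_const_one, mul_one]

theorem sum_condWeight {x : Option Bool} {c : Bool} (hx : x ≠ some c) {t : ℝ}
    (τ : Fin l → Option Bool) (h : (1 - t) ^ stars τ ≠ 1) : ∑ σ, condWeight x c t τ σ = 1 := by
  unfold condWeight
  have h1 : ∀ σ, (if σ = fill c τ then 0 else prodWeight x c t τ σ / (1 - (1 - t) ^ stars τ)) =
      (prodWeight x c t τ σ - if σ = fill c τ then prodWeight x c t τ (fill c τ) else 0) /
        (1 - (1 - t) ^ stars τ) := by
    intro σ
    split_ifs with hσ
    · simp [hσ]
    · simp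
  rw [Finset.sum_congr rfl fun σ _ => h1 σ, ← Finset.sum_div, Finset.sum_sub_distrib,
    sum_prodWeight hx, Finset.sum_ite_eq' Finset.univ, if_pos (Finset.mem_univ _),
    prodWeight_fill hx, div_self]
  exact sub_ne_zero.2 h.symm

theorem sum_mixWeight (lam q : ℝ) (c : Bool) {t : ℝ} (τ : Fin l → Option Bool)
    (h : (1 - t) ^ stars τ ≠ 1) : ∑ σ, mixWeight lam q c t τ σ = 1 := by
  unfold mixWeight
  rw [Finset.sum_add_distrib, Finset.sum_add_distrib, ← Finset.mul_sum, ← Finset.mul_sum,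
    sum_condWeight (by simp) τ h, sum_condWeight (by simp) τ h, Finset.sum_ite_eq',
    if_pos (Finset.mem_univ _)]
  ring

theorem condWeight_nonneg (x : Option Bool) (c : Bool) {t : ℝ} (h0 : 0 ≤ t) (h1 : t ≤ 1)
    (τ σ : Fin l → Option Bool) : 0 ≤ condWeight x c t τ σ := by
  unfold condWeight
  split_ifs
  · exact le_rfl
  · refine div_nonneg (prodWeight_nonneg x c h0 h1 τ σ) (sub_nonneg.2 (pow_le_one₀ ?_ ?_)) <;>
      linarith

/-- Encoding at most `r` of the free coordinates as a term demands costs a factor `(1 - t)⁻ʳ`. -/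
theorem sum_encode_prodWeight_le {c : Bool} {t : ℝ} (h0 : 0 < t) (h1 : t < 1)
    {r : ℕ} (τ U y : Fin l → Option Bool)
    (hU : (Finset.univ.filter fun i => U i ≠ none).card ≤ r) :
    ∑ x, (if encode (!c) U x = y then prodWeight none c t τ x else 0) ≤
      (1 / (1 - t)) ^ r * prodWeight (some (!c)) c t τ y := by
  have ht : 0 < 1 - t := by linarith
  have hκ : 1 ≤ 1 / (1 - t) := by rw [le_div_iff₀ ht]; linarith
  have hκ' : 1 / (1 - t) * (1 - t) = 1 := by field_simp
  generalize 1 / (1 - t) = κ at hκ hκ'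
  have e1 : ∀ x : Fin l → Option Bool,
      (if encode (!c) U x = y then prodWeight none c t τ x else 0) =
      ∏ i, (if some ((x i).getD ((U i).getD (!c))) = y i then
        (if τ i = none then (if x i = none then t else if x i = some c then 1 - t else 0)
          else if x i = τ i then (1 : ℝ) else 0) else 0) := by
    intro x
    split_ifs with hx
    · refine Finset.prod_congr rfl fun i _ => ?_
      exact (if_pos (congrFun hx i)).symm
    · obtain ⟨i, hi⟩ := Function.ne_iff.mp hx
      rw [Finset.prod_eq_zero (Finset.mem_univ i)]
      exact if_neg hi
  rw [Finset.sum_congr rfl fun x _ => e1 x, sum_prod_coord (fun i b =>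
      (if some (b.getD ((U i).getD (!c))) = y i then
        (if τ i = none then (if b = none then t else if b = some c then 1 - t else 0)
          else if b = τ i then (1 : ℝ) else 0) else 0))]
  have e2 : ∏ i, (if U i ≠ none then κ else 1) ≤ κ ^ r := by
    rw [Finset.prod_ite, Finset.prod_const, Finset.prod_const_one, mul_one]
    exact pow_le_pow_right₀ hκ hU
  refine le_trans ?_ (mul_le_mul_of_nonneg_right e2 (prodWeight_nonneg _ _ h0.le h1.le τ y))
  unfold prodWeight
  rw [← Finset.prod_mul_distrib]
  refine Finset.prod_le_prod (fun i _ => Finset.sum_nonneg fun b _ => ?_) fun i _ => ?_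
  · split_ifs <;> linarith
  -- The only real loss is at a coordinate free in `τ` for which `U` demands `∘`: the masses `t` of
  -- `∗` and `1 - t` of `∘` both land on `∘`, and their sum 1 equals `κ * (1 - t)`. Where `U` is
  -- silent or demands `•`, `∗` goes to `•`, of the same weight `t`.
  · have hκt : t ≤ κ * t := by nlinarith
    generalize τ i = a, U i = u, y i = z
    rcases a with _ | _ | _ <;> rcases u with _ | _ | _ <;> rcases z with _ | _ | _ <;>
      rcases c with _ | _ <;> simp [Fintype.sum_option] <;> linarith

/-- This distribution produces no free coordinate, so any `δ ≥ 0` will do. -/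
theorem blockGood_prodWeight {c : Bool} {t δ : ℝ} (hδ : 0 ≤ δ) (h0 : 0 ≤ t) (h1 : t ≤ 1) (r : ℕ)
    (τ : Fin l → Option Bool) :
    BlockGood (!c) r δ (prodWeight (some (!c)) c t τ) := by
  refine ⟨fun x => prodWeight_nonneg _ _ h0 h1 τ x, fun U _ y => ?_⟩
  rw [Finset.sum_eq_zero]
  · exact mul_nonneg hδ (prodWeight_nonneg _ _ h0 h1 τ y)
  · intro x _
    split_ifs with h
    · exact prodWeight_eq_zero_of_free t τ h.1
    · rfl

/-- A block with stars comes from the part of weight `q`. Its image under the encoding is compared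
with the part of weight `1 - lam - q` (condition `hδ1`), unless the image is constantly `∘`. That
string is excluded from both conditioned parts, and only the weight `lam` can pay for it (condition
`hδ2`). -/
theorem blockGood_mixWeight {c : Bool} {lam q t δ : ℝ} (hδ : 0 ≤ δ) (hlam : 0 ≤ lam) (hq : 0 ≤ q)
    (hlq : lam + q ≤ 1) (h0 : 0 < t) (h1 : t < 1) (r : ℕ) (τ : Fin l → Option Bool)
    (hS : 0 < stars τ) (hδ1 : q ≤ δ * (1 - lam - q))
    (hδ2 : q * (1 - t) ^ stars τ ≤ δ * (lam * (1 - (1 - t) ^ stars τ))) :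
    BlockGood (!c) r (δ * (1 / (1 - t)) ^ r) (mixWeight lam q c t τ) := by
  have hD : 0 < 1 - (1 - t) ^ stars τ :=
    sub_pos.2 (pow_lt_one₀ (by linarith) (by linarith) hS.ne')
  have ht : 0 < 1 - t := by linarith
  refine ⟨fun x => ?_, fun U hU y => ?_⟩
  · unfold mixWeight
    have a1 := condWeight_nonneg none c h0.le h1.le τ x
    have a2 := condWeight_nonneg (some (!c)) c h0.le h1.le τ x
    have a3 : 0 ≤ if x = fill c τ then lam else 0 := by split_ifs <;> linarith
    have a4 := mul_nonneg hq a1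
    have a5 := mul_nonneg (by linarith : 0 ≤ 1 - lam - q) a2
    linarith
  · have e1 : ∑ x, (if (∃ i, x i = none) ∧ encode (!c) U x = y then mixWeight lam q c t τ x else 0)
        ≤ q / (1 - (1 - t) ^ stars τ) *
          ∑ x, (if encode (!c) U x = y then prodWeight none c t τ x else 0) := by
      rw [Finset.mul_sum]
      refine Finset.sum_le_sum fun x _ => ?_
      have hp := prodWeight_nonneg none c h0.le h1.le τ x
      by_cases hx : (∃ i, x i = none) ∧ encode (!c) U x = y
      · rw [if_pos hx, if_pos hx.2]
        have hne : x ≠ fill c τ := by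
          rintro rfl
          obtain ⟨i, hi⟩ := hx.1
          simp [fill] at hi
        unfold mixWeight condWeight
        rw [if_neg hne, if_neg hne, if_neg hne, prodWeight_eq_zero_of_free t τ hx.1]
        apply le_of_eq; ring
      · rw [if_neg hx]
        have : 0 ≤ q / (1 - (1 - t) ^ stars τ) := div_nonneg hq hD.le
        split_ifs
        · exact mul_nonneg this hp
        · simp
    have hκ : 0 ≤ (1 / (1 - t)) ^ r := by positivity
    have hW := prodWeight_nonneg (some (!c)) c h0.le h1.le τ y
    have e2 := mul_le_mul_of_nonneg_left (sum_encode_prodWeight_le (c := c) h0 h1 τ U y hU)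
      (div_nonneg hq hD.le)
    refine e1.trans (e2.trans ?_)
    have e3 : q / (1 - (1 - t) ^ stars τ) * prodWeight (some (!c)) c t τ y ≤
        δ * mixWeight lam q c t τ y := by
      unfold mixWeight
      by_cases hy : y = fill c τ
      · subst hy
        rw [prodWeight_fill (by simp)]
        simp only [condWeight, if_true, mul_zero, add_zero]
        rw [div_mul_eq_mul_div, div_le_iff₀ hD]
        linarith
      · simp only [condWeight, hy, if_false, zero_add]
        have a1 := mul_nonneg hq (div_nonneg (prodWeight_nonneg none c h0.le h1.le τ y) hD.le)
        have a2 := mul_le_mul_of_nonneg_right hδ1 (div_nonneg hW hD.le)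
        rw [div_mul_eq_mul_div, mul_div_assoc]
        nlinarith [mul_nonneg hδ a1]
    calc _ = (1 / (1 - t)) ^ r *
          (q / (1 - (1 - t) ^ stars τ) * prodWeight (some (!c)) c t τ y) := by ring
      _ ≤ (1 / (1 - t)) ^ r * (δ * mixWeight lam q c t τ y) := mul_le_mul_of_nonneg_left e3 hκ
      _ = _ := by ring

end Blocks

/-! ### From one layer of a circuit to the next. -/

section Circuits

open Classical

/-- Every coordinate of `Φ` is a constant or an input variable. -/
def CoordwiseSimple {V V' : Type} (Φ : (V' → Bool) → V → Bool) : Prop :=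
  ∀ v, (∃ b, ∀ y, Φ y v = b) ∨ ∃ a, ∀ y, Φ y v = y a

/-- The substitution on inputs that underlies `proj`. -/
def projMap {A : Type} {l : ℕ} (ρ : Restr (A × Fin l)) (y : A → Bool) : A × Fin l → Bool :=
  fun x => (ρ x).getD (y x.1)

theorem CoordwiseSimple.comp_projMap {V A : Type} {l : ℕ} {Φ : (A × Fin l → Bool) → V → Bool}
    (h : CoordwiseSimple Φ) (ρ : Restr (A × Fin l)) :
    CoordwiseSimple fun y => Φ (projMap ρ y) := by
  intro v
  rcases h v with ⟨b, hb⟩ | ⟨x, hx⟩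
  · exact Or.inl ⟨b, fun y => hb _⟩
  · rcases hρ : ρ x with _ | b
    · exact Or.inr ⟨x.1, fun y => by simp [hx, projMap, hρ]⟩
    · exact Or.inl ⟨b, fun y => by simp [hx, projMap, hρ]⟩

/-- This handles the literals that feed gates above the bottom layer: after any number of
projections they still depend on at most one variable. -/
theorem CoordwiseSimple.cert {V V' : Type} [Fintype V'] {Φ : (V' → Bool) → V → Bool}
    (h : CoordwiseSimple Φ) (v : V) (b : Bool) {r : ℕ} (hr : 1 ≤ r) :
    Cert r fun y => decide (Φ y v = b) := by
  suffices HasTree (fun y => decide (Φ y v = b)) 1 from this.cert.mono hr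
  rcases h v with ⟨c, hc⟩ | ⟨a, ha⟩
  · simp only [hc]
    exact hasTree_const _ _
  · refine ⟨.node a (.leaf (!b)) (.leaf b), by simp [DTree.depth], fun y => ?_⟩
    simp only [DTree.eval, ha]
    cases y a <;> cases b <;> rfl

variable {V : Type} {d : ℕ}

/-- A gate, up to negation, as a disjunction. -/
def LayeredCircuit.orVal (C : LayeredCircuit V d) (x : V → Bool) (i j : ℕ)
    (g : Fin (C.numGates j)) : Bool :=
  if C.isAnd i then !(C.gateVal x j g) else C.gateVal x j g

theorem LayeredCircuit.isAnd_succ (C : LayeredCircuit V d) (i : ℕ) :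
    C.isAnd (i + 1) = !(C.isAnd i) := by
  unfold LayeredCircuit.isAnd
  by_cases h : Even i <;> simp [h, Nat.even_add_one]

/-- If the gates of a layer have small certificates, then so do those of the next layer. -/
theorem LayeredCircuit.cert_orVal_succ {V' : Type} [Fintype V'] (C : LayeredCircuit V d)
    {Φ : (V' → Bool) → V → Bool} (hΦ : CoordwiseSimple Φ) (i : ℕ) {r : ℕ} (hr : 1 ≤ r)
    (h : ∀ g, Cert r fun y => C.orVal (Φ y) (i + 1) i g) (g : Fin (C.numGates (i + 1))) :
    Cert r fun y => C.orVal (Φ y) (i + 1) (i + 1) g := by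
  -- By De Morgan, negating an AND gate and its inputs makes it an OR. A certificate for one true
  -- input certifies the OR, so the fan-in costs nothing.
  have hval : ∀ y, C.orVal (Φ y) (i + 1) (i + 1) g = true ↔
      (∃ l ∈ C.lits (i + 1) g, Φ y l.1 = (if C.isAnd (i + 1) then !l.2 else l.2)) ∨
      ∃ k ∈ C.kids i g, C.orVal (Φ y) (i + 1) i k = true := by
    intro y
    by_cases hA : C.isAnd (i + 1) = true
    · simp only [LayeredCircuit.orVal, LayeredCircuit.gateVal, hA, if_true, Bool.not_eq_true',
        decide_eq_false_iff_not, not_and_or, not_forall, Bool.not_eq_true]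
      simp only [exists_prop, Bool.eq_not]
    · rw [Bool.not_eq_true] at hA
      simp only [LayeredCircuit.orVal, LayeredCircuit.gateVal, hA, Bool.false_eq_true, if_false,
        decide_eq_true_iff]
  intro x hx
  rcases (hval x).1 hx with ⟨l, hl, hlx⟩ | ⟨k, hk, hkx⟩
  · obtain ⟨T, h1, h2, h3⟩ := hΦ.cert l.1 (if C.isAnd (i + 1) then !l.2 else l.2) hr x
      (decide_eq_true hlx)
    exact ⟨T, h1, h2, fun y hy => (hval y).2 (Or.inl ⟨l, hl, of_decide_eq_true (h3 y hy)⟩)⟩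
  · obtain ⟨T, h1, h2, h3⟩ := h k x hkx
    exact ⟨T, h1, h2, fun y hy => (hval y).2 (Or.inr ⟨k, hk, h3 y hy⟩)⟩

/-- Since the gate types alternate, a bottom gate seen from layer 1 is a conjunction of literals,
after negation if necessary. -/
theorem LayeredCircuit.cert_orVal_zero [Fintype V] (C : LayeredCircuit V d) {r : ℕ}
    (hr : C.bottomFanIn ≤ r) (g : Fin (C.numGates 0)) :
    Cert r fun x => C.orVal x 1 0 g := by
  have hval : ∀ x, C.orVal x 1 0 g = true ↔
      ∀ l ∈ C.lits 0 g, x l.1 = (if C.isAnd 0 then l.2 else !l.2) := by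
    intro x
    have h1 := C.isAnd_succ 0
    rw [zero_add] at h1
    by_cases hA : C.isAnd 0 = true
    · simp [LayeredCircuit.orVal, LayeredCircuit.gateVal, hA, h1]
    · rw [Bool.not_eq_true] at hA
      simp only [LayeredCircuit.orVal, LayeredCircuit.gateVal, hA, h1, Bool.not_false, if_true,
        Bool.false_eq_true, if_false, Bool.not_eq_true', decide_eq_false_iff_not, not_exists,
        not_and, Bool.eq_not, ne_eq]
  have hcard : (C.lits 0 g).card ≤ r :=
    (Finset.le_sup (f := fun g : Fin (C.numGates 0) => (C.lits 0 g).card)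
      (Finset.mem_univ g)).trans hr
  intro x hx
  rw [hval] at hx
  refine ⟨fun v => if ∃ b, (v, b) ∈ C.lits 0 g then some (x v) else none, ?_, ?_, ?_⟩
  · refine le_trans ?_ hcard
    refine (Finset.card_le_card (t := (C.lits 0 g).image Prod.fst) fun v hv => ?_).trans
      Finset.card_image_le
    simp only [Finset.mem_filter, Finset.mem_univ, true_and, ne_eq, ite_eq_right_iff,
      not_forall] at hv
    obtain ⟨⟨b, hb⟩, -⟩ := hv
    exact Finset.mem_image.2 ⟨(v, b), hb, rfl⟩
  · intro v b h
    by_cases hv : ∃ b, (v, b) ∈ C.lits 0 g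
    · simpa [hv] using h
    · simp [hv] at h
  · intro y hy
    rw [hval]
    intro l hl
    rw [← hx l hl]
    exact hy l.1 (x l.1) (if_pos ⟨l.2, hl⟩)

theorem LayeredCircuit.cert_orVal_of_hasTree {V' : Type} [Fintype V'] (C : LayeredCircuit V d)
    {Φ : (V' → Bool) → V → Bool} (i j : ℕ) (g : Fin (C.numGates j)) {s : ℕ}
    (h : HasTree (fun y => C.gateVal (Φ y) j g) s) : Cert s fun y => C.orVal (Φ y) i j g := by
  unfold LayeredCircuit.orVal
  split_ifs
  · exact h.not.cert
  · exact h.cert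

theorem LayeredCircuit.hasTree_of_orVal {V' : Type} (C : LayeredCircuit V d)
    {Φ : (V' → Bool) → V → Bool} (i j : ℕ) (g : Fin (C.numGates j)) {s : ℕ}
    (h : HasTree (fun y => C.orVal (Φ y) i j g) s) : HasTree (fun y => C.gateVal (Φ y) j g) s := by
  unfold LayeredCircuit.orVal at h
  split_ifs at h
  · simpa using h.not
  · exact h

end Circuits

/-! ### Probabilities of failure under the random restrictions. -/

section Laws

open Classical ENNReal

theorem lawOf_toOuterMeasure {α : Type} [Fintype α] [Inhabited α] {W : α → ℝ}
    (h0 : ∀ a, 0 ≤ W a) (h1 : ∑ a, W a = 1) (S : Set α) :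
    (lawOf W).toOuterMeasure S = ENNReal.ofReal (∑ a, if a ∈ S then W a else 0) := by
  rw [PMF.toOuterMeasure_apply_fintype, ENNReal.ofReal_sum_of_nonneg]
  · refine Finset.sum_congr rfl fun a _ => ?_
    rw [lawOf, dif_pos ⟨h0, h1⟩, Set.indicator_apply]
    split_ifs
    · rfl
    · simp
  · intro a _
    split_ifs
    · exact h0 a
    · exact le_rfl

/-- The union bound for one stage: either the restriction is in the bad set `B`, or the later stages
fail with probability at most `e`. -/
theorem bind_toOuterMeasure_le {α β : Type} (p : PMF α) (f : α → PMF β) (S : Set β) (B : Set α)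
    (e : ℝ≥0∞) (h : ∀ a ∉ B, (f a).toOuterMeasure S ≤ e) :
    (p.bind f).toOuterMeasure S ≤ p.toOuterMeasure B + e := by
  rw [PMF.toOuterMeasure_bind_apply, PMF.toOuterMeasure_apply]
  have h1 : ∀ a, p a * (f a).toOuterMeasure S ≤ B.indicator p a + p a * e := by
    intro a
    by_cases ha : a ∈ B
    · rw [Set.indicator_of_mem ha]
      refine le_trans ?_ le_self_add
      refine mul_le_of_le_one_right' ?_
      rw [PMF.toOuterMeasure_apply, ← (f a).tsum_coe]
      exact ENNReal.tsum_le_tsum fun b => Set.indicator_le_self _ _ _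
    · rw [Set.indicator_of_notMem ha, zero_add]
      gcongr
      exact h a ha
  refine (ENNReal.tsum_le_tsum h1).trans ?_
  rw [ENNReal.tsum_add, ENNReal.tsum_mul_right, p.tsum_coe, one_mul]

theorem one_sub_le_toOuterMeasure {α : Type} (p : PMF α) (S : Set α) {e : ℝ}
    (he : 0 ≤ e) (h : p.toOuterMeasure Sᶜ ≤ ENNReal.ofReal e) :
    1 - e ≤ (p.toOuterMeasure S).toReal := by
  have h1 : p.toOuterMeasure S + p.toOuterMeasure Sᶜ = 1 := by
    rw [PMF.toOuterMeasure_apply, PMF.toOuterMeasure_apply, ← ENNReal.tsum_add, ← p.tsum_coe]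
    refine tsum_congr fun a => ?_
    by_cases ha : a ∈ S <;> simp [ha]
  have h2 : p.toOuterMeasure S ≠ ∞ := by
    intro h; rw [h] at h1; simp at h1
  have h3 : (1 : ℝ≥0∞) ≤ ENNReal.ofReal ((p.toOuterMeasure S).toReal + e) := by
    rw [ENNReal.ofReal_add ENNReal.toReal_nonneg he, ENNReal.ofReal_toReal h2, ← h1]
    gcongr
  rw [ENNReal.one_le_ofReal] at h3
  linarith

/-- A product of good block weights that sum to one makes a projection shallow, simultaneously for
several functions with small certificates. -/
theorem lawOf_exists_not_hasTree_le {A : Type} [Fintype A] [DecidableEq A] {l : ℕ} {b : Bool}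
    {r : ℕ} {δ ε : ℝ} (hδ : 0 ≤ δ) (hε : 0 < ε) (hε1 : ε ≤ 1) (h : (1 + 2 * δ / ε) ^ r ≤ 2)
    (μ : A → (Fin l → Option Bool) → ℝ) (hμ : ∀ a, BlockGood b r δ (μ a))
    (hμ1 : ∀ a, ∑ x, μ a x = 1) (s N : ℕ) (f : Fin N → BoolFun (A × Fin l))
    (hf : ∀ g, Cert r (f g)) :
    (lawOf fun ρ : Restr (A × Fin l) => ∏ a, μ a fun i => ρ (a, i)).toOuterMeasure
      {ρ | ∃ g, ¬ HasTree (proj ρ (f g)) s} ≤ N * ENNReal.ofReal (ε ^ (s + 1)) := by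
  have h0 : ∀ ρ : Restr (A × Fin l), 0 ≤ ∏ a, μ a fun i => ρ (a, i) := fun ρ =>
    Finset.prod_nonneg fun a _ => (hμ a).1 _
  have h1 : ∑ ρ : Restr (A × Fin l), ∏ a, (μ a fun i => ρ (a, i)) = 1 := by
    have e1 : ∑ ρ : Restr (A × Fin l), ∏ a, (μ a fun i => ρ (a, i)) =
        ∑ ρ : A → Fin l → Option Bool, ∏ a, μ a (ρ a) :=
      Fintype.sum_equiv (Equiv.curry A (Fin l) (Option Bool)) _ _ fun ρ => rfl
    rw [e1, sum_prod_coord]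
    exact Finset.prod_eq_one fun a _ => hμ1 a
  have h2 : {ρ : Restr (A × Fin l) | ∃ g, ¬ HasTree (proj ρ (f g)) s} =
      ⋃ g, {ρ | ¬ HasTree (proj ρ (f g)) s} := by ext; simp
  rw [h2]
  refine (MeasureTheory.measure_iUnion_fintype_le _ _).trans ?_
  calc _ ≤ ∑ _g : Fin N, ENNReal.ofReal (ε ^ (s + 1)) := by
        refine Finset.sum_le_sum fun g _ => ?_
        rw [lawOf_toOuterMeasure h0 h1]
        refine ENNReal.ofReal_le_ofReal ?_
        have := sum_not_hasTree_proj_le hδ hε hε1 h (hf g) μ hμ s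
        rw [h1, mul_one] at this
        convert this
    _ = _ := by simp

end Laws

/-! ### The stages of the random projection, one layer each. -/

section Stages

open Classical ENNReal

/-- The conditions on the parameters under which the random projection simplifies circuits: `r₀`
bounds the bottom fan-in, and `s` the depth of the decision trees. -/
structure Simplifies (m d r₀ s : ℕ) (ε : ℝ) : Prop where
  one_le_r₀ : 1 ≤ r₀
  one_le_s : 1 ≤ s
  eps_pos : 0 < ε
  eps_le : ε ≤ 1
  init : ∃ δ, 0 ≤ δ ∧ (1 + 2 * δ / ε) ^ r₀ ≤ 2 ∧ ∀ j, j + 1 = d →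
    BlockGood (l := fanIn m d j) false r₀ δ
      (mixWeight (lamPar m) (qPar m) true (1 / 2) fun _ => none) ∧
    ∑ x : Fin (fanIn m d j) → Option Bool,
      mixWeight (lamPar m) (qPar m) true (1 / 2) (fun _ => none) x = 1
  next : ∃ δ, 0 ≤ δ ∧ (1 + 2 * δ / ε) ^ s ≤ 2 ∧ ∀ k, 2 ≤ k → k ≤ d - 1 →
    ∀ (l : ℕ) (liftVal : Option Bool) (τ : Fin l → Option Bool), (liftVal = none → 0 < stars τ) →
      BlockGood (!circ d k) s δ (blockWeight m d k liftVal τ) ∧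
      ∑ x, blockWeight m d k liftVal τ x = 1

variable {m d r₀ s : ℕ} {ε : ℝ}

/-- A free coordinate makes the conditioning on not being constantly `∘` meaningful, so that the
block weights sum to one. -/
theorem stars_pos_of_lift_eq_none {A : Type} {l : ℕ} {c : Bool} {τ : Restr (A × Fin l)} {a : A}
    (h : lift c τ a = none) : 0 < stars fun i => τ (a, i) := by
  unfold lift at h
  split_ifs at h with h1 h2
  push Not at h2
  obtain ⟨i, hi⟩ := h2
  refine Finset.card_pos.2 ⟨i, ?_⟩
  simp only [Finset.mem_filter, Finset.mem_univ, true_and]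
  rcases hτ : τ (a, i) with _ | v
  · rfl
  · exfalso
    by_cases hv : v = c
    · exact hi (by rw [hτ, hv])
    · exact h1 ⟨i, by rw [hτ]; congr; revert hv; cases v <;> cases c <;> simp⟩

/-- The invariant is that the gates of layer `i` are trees of depth `s`. One more projection passes
it to layer `i + 1`, unless one of that layer's gates fails. The bound is uniform in `τ`, because
`BlockGood` holds for every block. -/
theorem psiFrom_not_hasTree_le {V : Type} (H : Simplifies m d r₀ s ε) (C : LayeredCircuit V d) :
    ∀ (j : ℕ), j + 2 ≤ d → ∀ (τ : Restr (SAddr m d (j + 1)))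
      (Φ : (SAddr m d (j + 1) → Bool) → V → Bool), CoordwiseSimple Φ →
      ∀ i, i + j + 1 = d → (∀ g, HasTree (fun y => C.gateVal (Φ y) i g) s) →
      (psiFrom m d j τ fun y => C.eval (Φ y)).toOuterMeasure {f | ¬ HasTree f s} ≤
        (∑ k ∈ Finset.Ico (i + 1) d, C.numGates k : ℕ) * ENNReal.ofReal (ε ^ (s + 1)) := by
  intro j
  induction j with
  | zero =>
    intro _ τ Φ _ i hi h
    have hid : i = d - 1 := by omega
    subst hid
    have : HasTree (fun y => C.eval (Φ y)) s := h C.output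
    rw [psiFrom, PMF.toOuterMeasure_pure_apply, if_neg (by simpa using this)]
    exact zero_le
  | succ j ih =>
    intro hj τ Φ hΦ i hi h
    obtain ⟨δ, hδ, hδr, hgood⟩ := H.next
    rw [psiFrom, Finset.sum_eq_sum_Ico_succ_bot (by omega : i + 1 < d), Nat.cast_add, add_mul]
    have hcert : ∀ g, Cert s fun y => C.orVal (Φ y) (i + 1) (i + 1) g :=
      C.cert_orVal_succ hΦ i H.one_le_s fun g => C.cert_orVal_of_hasTree _ _ g (h g)
    have hlaw := lawOf_exists_not_hasTree_le hδ H.eps_pos H.eps_le hδr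
      (fun a : SAddr m d (j + 1) => blockWeight m d (j + 2) (lift (circ d (j + 2)) τ a)
        (fun i => τ (a, i)))
      (fun a => (hgood (j + 2) (by omega) (by omega) _ _ _ stars_pos_of_lift_eq_none).1)
      (fun a => (hgood (j + 2) (by omega) (by omega) _ _ _ stars_pos_of_lift_eq_none).2)
      s _ (fun g y => C.orVal (Φ y) (i + 1) (i + 1) g) hcert
    refine (bind_toOuterMeasure_le _ _ _ _ _ fun ρ hρ => ?_).trans (add_le_add hlaw le_rfl)
    simp only [Set.mem_ofPred_eq, not_exists, not_not] at hρ
    exact ih (by omega) _ _ (hΦ.comp_projMap ρ) (i + 1) (by omega) fun g =>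
      C.hasTree_of_orVal (i + 1) (i + 1) g (hρ g)

/-- The initial restriction collapses layers 0 and 1 at once: a gate of layer 1 is a DNF of width
`r₀` up to negation. This stage needs its own width bound, as its blocks are drawn with parameter
`1/2` rather than a small `t_k`. -/
theorem psi_not_hasTree_le (hd : 2 ≤ d) (H : Simplifies m d r₀ s ε)
    (C : LayeredCircuit (SAddr m d d) d) (hC : C.bottomFanIn ≤ r₀) :
    (psi m d C.eval).toOuterMeasure {f | ¬ HasTree f s} ≤
      (C.size : ℕ) * ENNReal.ofReal (ε ^ (s + 1)) := by
  obtain ⟨e, rfl⟩ : ∃ e, d = e + 2 := ⟨d - 2, by omega⟩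
  obtain ⟨δ, hδ, hδr, hgood⟩ := H.init
  have hid : CoordwiseSimple fun y : SAddr m (e + 2) (e + 2) → Bool => y :=
    fun v => Or.inr ⟨v, fun _ => rfl⟩
  have hcert : ∀ g, Cert r₀ fun y => C.orVal y 1 1 g :=
    C.cert_orVal_succ hid 0 H.one_le_r₀ (C.cert_orVal_zero hC)
  have hlaw := lawOf_exists_not_hasTree_le hδ H.eps_pos H.eps_le hδr
    (fun _ : SAddr m (e + 2) (e + 1) => mixWeight (lamPar m) (qPar m) true (1 / 2) fun _ => none)
    (fun a => (hgood (e + 1) rfl).1) (fun a => (hgood (e + 1) rfl).2)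
    s _ (fun g y => C.orVal y 1 1 g) hcert
  have hsize : C.numGates 1 + ∑ k ∈ Finset.Ico 2 (e + 2), C.numGates k ≤ C.size := by
    rw [← Finset.sum_eq_sum_Ico_succ_bot (by omega : 1 < e + 2), LayeredCircuit.size,
      Finset.range_eq_Ico]
    exact Finset.sum_le_sum_of_subset (Finset.Ico_subset_Ico_left (by omega))
  calc _ ≤ (C.numGates 1 : ℝ≥0∞) * ENNReal.ofReal (ε ^ (s + 1)) +
        (∑ k ∈ Finset.Ico 2 (e + 2), C.numGates k : ℕ) * ENNReal.ofReal (ε ^ (s + 1)) := by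
        rw [psi]
        refine (bind_toOuterMeasure_le _ _ _ _ _ fun ρ hρ => ?_).trans (add_le_add hlaw le_rfl)
        simp only [Set.mem_ofPred_eq, not_exists, not_not] at hρ
        exact psiFrom_not_hasTree_le H C e le_rfl _ _ (hid.comp_projMap ρ) 1 (by omega) fun g =>
          C.hasTree_of_orVal 1 1 g (hρ g)
    _ ≤ _ := by
        rw [← add_mul, ← Nat.cast_add]
        gcongr

theorem one_sub_le_probShallow (hd : 2 ≤ d) (H : Simplifies m d r₀ s ε)
    (C : LayeredCircuit (SAddr m d d) d) (hC : C.bottomFanIn ≤ r₀) {R : ℝ} (hR : (s : ℝ) ≤ R) :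
    1 - C.size * ε ^ (s + 1) ≤ probShallow m d C.eval R := by
  have hε := H.eps_pos
  refine one_sub_le_toOuterMeasure _ _ (by positivity) ?_
  rw [ENNReal.ofReal_mul (by positivity), ENNReal.ofReal_natCast]
  refine le_trans (MeasureTheory.OuterMeasure.mono _ fun f hf => ?_) (psi_not_hasTree_le hd H C hC)
  rintro ⟨T, h1, h2⟩
  exact hf ⟨T, le_trans (by exact_mod_cast h1) hR, h2⟩

end Stages

/-! ### Estimates for the parameters, in powers of `Q = qRoot m`. -/

section Parameters

/-- `2 ^ (-m / 24)`; the parameters are compared with powers of this number. -/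
def qRoot (m : ℕ) : ℝ := (2 : ℝ) ^ (-(m : ℝ) / 24)

/-- `m` is large enough for all the estimates. -/
structure Large (m : ℕ) : Prop where
  le : 100 ≤ m
  small : 10000 * (m : ℝ) ^ 3 * qRoot m ^ 2 ≤ 1

theorem exists_forall_large : ∃ m₀, ∀ m, m₀ ≤ m → Large m := by
  have hr : |(2 : ℝ) ^ (-(1 : ℝ) / 12)| < 1 := by
    rw [abs_of_pos (by positivity)]
    exact Real.rpow_lt_one_of_one_lt_of_neg (by norm_num) (by norm_num)
  have h1 := tendsto_pow_const_mul_const_pow_of_abs_lt_one 3 hr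
  have h2 := h1.eventually (gt_mem_nhds (show (0 : ℝ) < 1 / 10000 by norm_num))
  obtain ⟨M, hM⟩ := Filter.eventually_atTop.1 h2
  refine ⟨max M 100, fun m hm => ⟨(le_max_right _ _).trans hm, ?_⟩⟩
  have h3 := hM m ((le_max_left _ _).trans hm)
  have h4 : qRoot m ^ 2 = ((2 : ℝ) ^ (-(1 : ℝ) / 12)) ^ m := by
    rw [qRoot, ← Real.rpow_natCast, ← Real.rpow_natCast, ← Real.rpow_mul (by norm_num),
      ← Real.rpow_mul (by norm_num)]
    congr 1; push_cast; ring
  rw [h4]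
  linarith

theorem qRoot_pos (m : ℕ) : 0 < qRoot m := by unfold qRoot; positivity

theorem qRoot_le_one (m : ℕ) : qRoot m ≤ 1 :=
  Real.rpow_le_one_of_one_le_of_nonpos (by norm_num)
    (div_nonpos_of_nonpos_of_nonneg (neg_nonpos.2 (Nat.cast_nonneg m)) (by norm_num))

theorem qRoot_pow (m k : ℕ) : qRoot m ^ k = (2 : ℝ) ^ (-(m : ℝ) * k / 24) := by
  rw [qRoot, ← Real.rpow_natCast, ← Real.rpow_mul (by norm_num)]
  congr 1; ring

theorem inv_qRoot_pow (m k : ℕ) : (qRoot m ^ k)⁻¹ = (2 : ℝ) ^ ((m : ℝ) * k / 24) := by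
  rw [qRoot_pow, ← Real.rpow_neg (by norm_num)]
  congr 1; ring

theorem pPar_eq (m : ℕ) : pPar m = qRoot m ^ 24 := by
  rw [qRoot_pow, pPar]; congr 1; push_cast; ring

theorem qPar_eq (m : ℕ) : qPar m = qRoot m ^ 12 := by
  rw [qRoot_pow, qPar]; congr 1; push_cast; ring

theorem two_pow_eq (m : ℕ) : (2 : ℝ) ^ m = (qRoot m ^ 24)⁻¹ := by
  rw [inv_qRoot_pow, ← Real.rpow_natCast]; congr 1; push_cast; ring

theorem wPar_eq (m : ℕ) : wPar m = ⌊(m : ℝ) * 2 ^ m * Real.log 2⌋₊ := by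
  unfold wPar
  rw [Real.logb, Real.log_exp, div_div_eq_mul_div, div_one]

theorem wPar_le (m : ℕ) : (wPar m : ℝ) ≤ m * 2 ^ m * Real.log 2 := by
  rw [wPar_eq]
  exact Nat.floor_le (by have := Real.log_nonneg (show (1 : ℝ) ≤ 2 by norm_num); positivity)

theorem wPar_le' (m : ℕ) : (wPar m : ℝ) ≤ m * 2 ^ m :=
  (wPar_le m).trans (mul_le_of_le_one_right (by positivity)
    (by linarith [Real.log_two_lt_d9]))

theorem lt_wPar_add_one (m : ℕ) : (m : ℝ) * 2 ^ m * Real.log 2 < wPar m + 1 := by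
  rw [wPar_eq]
  exact Nat.lt_floor_add_one _

variable {m : ℕ}

theorem Large.le_cast (h : Large m) : (100 : ℝ) ≤ m := by exact_mod_cast h.le

/-- Every power of `qRoot m` beyond the second kills the cube of `m`. -/
theorem Large.mul_pow_le (h : Large m) {j k : ℕ} (hj : j ≤ 3) (hk : 2 ≤ k) :
    (m : ℝ) ^ j * qRoot m ^ k ≤ 1 / 10000 := by
  have h1 := h.le_cast
  have h2 : (m : ℝ) ^ j ≤ (m : ℝ) ^ 3 := pow_le_pow_right₀ (by linarith) hj
  have h3 : qRoot m ^ k ≤ qRoot m ^ 2 :=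
    pow_le_pow_of_le_one (qRoot_pos m).le (qRoot_le_one m) hk
  have h4 : (m : ℝ) ^ j * qRoot m ^ k ≤ (m : ℝ) ^ 3 * qRoot m ^ 2 :=
    mul_le_mul h2 h3 (pow_nonneg (qRoot_pos m).le _) (by positivity)
  linarith [h.small]

theorem Large.two_pow_le_wPar (h : Large m) : (2 : ℝ) ^ m ≤ wPar m := by
  have h1 := h.le_cast
  have h2 := lt_wPar_add_one m
  have h3 := Real.log_two_gt_d9
  have h4 : (1 : ℝ) ≤ 2 ^ m := one_le_pow₀ (by norm_num)
  have h5 : (100 : ℝ) * 2 ^ m * (1 / 2) ≤ m * 2 ^ m * Real.log 2 := by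
    gcongr
    linarith
  linarith

theorem Large.le_logb (h : Large m) : (m : ℝ) ≤ Real.logb 2 (wPar m) := by
  rw [Real.le_logb_iff_rpow_le (by norm_num)
    (lt_of_lt_of_le (by positivity) h.two_pow_le_wPar), Real.rpow_natCast]
  exact h.two_pow_le_wPar

theorem Large.logb_le (h : Large m) : Real.logb 2 (wPar m) ≤ 2 * m := by
  rw [Real.logb_le_iff_le_rpow (by norm_num)
    (lt_of_lt_of_le (by positivity) h.two_pow_le_wPar)]
  have h1 : (m : ℝ) ≤ 2 ^ m := by exact_mod_cast (Nat.lt_two_pow_self (n := m)).le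
  calc (wPar m : ℝ) ≤ m * 2 ^ m := wPar_le' m
    _ ≤ 2 ^ m * 2 ^ m := by gcongr
    _ = _ := by rw [← pow_add, ← two_mul, ← Real.rpow_natCast]; push_cast; rfl

/-- Here `w` is at least `2^m` and `log₂ w` at most `2m`, so `λ` is at most `p^(5/4) = Q^30` times a
power of `m`. -/
theorem Large.lamPar_le (h : Large m) : lamPar m ≤ 4 * (m : ℝ) ^ 2 * qRoot m ^ 30 := by
  have h1 := h.le_cast
  have hL : 0 ≤ Real.logb 2 (wPar m) := by linarith [h.le_logb]
  have hnum : Real.logb 2 (wPar m) ^ (3 / 2 : ℝ) ≤ 4 * (m : ℝ) ^ 2 := by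
    calc _ ≤ (2 * (m : ℝ)) ^ (3 / 2 : ℝ) := Real.rpow_le_rpow hL h.logb_le (by norm_num)
      _ ≤ (2 * (m : ℝ)) ^ (2 : ℝ) :=
        Real.rpow_le_rpow_of_exponent_le (by linarith) (by norm_num)
      _ = _ := by rw [Real.rpow_two]; ring
  have hden : (qRoot m ^ 30)⁻¹ ≤ (wPar m : ℝ) ^ (5 / 4 : ℝ) := by
    calc (qRoot m ^ 30)⁻¹ = ((2 : ℝ) ^ m) ^ (5 / 4 : ℝ) := by
          rw [inv_qRoot_pow, ← Real.rpow_natCast, ← Real.rpow_mul (by norm_num)]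
          congr 1; push_cast; ring
      _ ≤ _ := Real.rpow_le_rpow (by positivity) h.two_pow_le_wPar (by norm_num)
  have hQ := pow_pos (qRoot_pos m) 30
  calc lamPar m ≤ 4 * (m : ℝ) ^ 2 / (qRoot m ^ 30)⁻¹ := by
        unfold lamPar; gcongr
    _ = _ := by rw [div_inv_eq_mul]

/-- No power of `m` is lost: the factor `m^(3/2)` from the logarithm outweighs the `m^(5/4)` in the
bound for `w^(5/4)`. -/
theorem Large.le_lamPar (h : Large m) : qRoot m ^ 30 ≤ lamPar m := by
  have h1 := h.le_cast
  have hnum : (m : ℝ) ^ (3 / 2 : ℝ) ≤ Real.logb 2 (wPar m) ^ (3 / 2 : ℝ) :=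
    Real.rpow_le_rpow (by linarith) h.le_logb (by norm_num)
  have hw : (0 : ℝ) < wPar m := lt_of_lt_of_le (by positivity) h.two_pow_le_wPar
  have hden : (wPar m : ℝ) ^ (5 / 4 : ℝ) ≤ (m : ℝ) ^ (3 / 2 : ℝ) * (qRoot m ^ 30)⁻¹ := by
    calc (wPar m : ℝ) ^ (5 / 4 : ℝ) ≤ ((m : ℝ) * 2 ^ m) ^ (5 / 4 : ℝ) :=
          Real.rpow_le_rpow (by positivity) (wPar_le' m) (by norm_num)
      _ = (m : ℝ) ^ (5 / 4 : ℝ) * (qRoot m ^ 30)⁻¹ := by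
          rw [Real.mul_rpow (by positivity) (by positivity), inv_qRoot_pow, ← Real.rpow_natCast,
            ← Real.rpow_mul (by norm_num)]
          congr 2; push_cast; ring
      _ ≤ _ := by
          have := inv_nonneg.2 (pow_nonneg (qRoot_pos m).le 30)
          gcongr ?_ * _
          exact Real.rpow_le_rpow_of_exponent_le (by linarith) (by norm_num)
  have hQ := pow_pos (qRoot_pos m) 30
  unfold lamPar
  rw [le_div_iff₀ (by positivity)]
  calc _ ≤ qRoot m ^ 30 * ((m : ℝ) ^ (3 / 2 : ℝ) * (qRoot m ^ 30)⁻¹) := by gcongr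
    _ = (m : ℝ) ^ (3 / 2 : ℝ) := by rw [mul_left_comm, mul_inv_cancel₀ hQ.ne', mul_one]
    _ ≤ _ := hnum

theorem Large.lamPar_pos (h : Large m) : 0 < lamPar m :=
  lt_of_lt_of_le (pow_pos (qRoot_pos m) 30) h.le_lamPar

theorem Large.qPar_le (h : Large m) : qPar m ≤ 1 / 10000 := by
  rw [qPar_eq]
  simpa using h.mul_pow_le (j := 0) (k := 12) (by norm_num) (by norm_num)

theorem qPar_pos (m : ℕ) : 0 < qPar m := by unfold qPar; positivity

theorem pPar_pos (m : ℕ) : 0 < pPar m := by unfold pPar; positivity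

theorem qPar_sq (m : ℕ) : qPar m ^ 2 = pPar m := by rw [pPar_eq, qPar_eq, ← pow_mul]

theorem Large.lamPar_le_pPar (h : Large m) : lamPar m ≤ pPar m / 1000 := by
  have h1 := h.lamPar_le
  have h2 := h.mul_pow_le (j := 2) (k := 6) (by norm_num) (by norm_num)
  have h3 := pPar_pos m
  have h4 : 4 * (m : ℝ) ^ 2 * qRoot m ^ 30 = 4 * ((m : ℝ) ^ 2 * qRoot m ^ 6) * pPar m := by
    rw [pPar_eq]; ring
  rw [h4] at h1
  nlinarith

theorem Large.pPar_le (h : Large m) : pPar m ≤ 1 / 10000 := by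
  rw [pPar_eq]
  simpa using h.mul_pow_le (j := 0) (k := 24) (by norm_num) (by norm_num)

theorem log_one_sub_bounds {y : ℝ} (hy1 : y ≤ 1 / 2) :
    -y - 2 * y ^ 2 ≤ Real.log (1 - y) ∧ Real.log (1 - y) ≤ -y := by
  constructor
  · refine le_trans ?_ (Real.one_sub_inv_le_log_of_pos (show 0 < 1 - y by linarith))
    have h1 : (1 - y)⁻¹ ≤ 1 + y + 2 * y ^ 2 := by
      rw [inv_le_iff_one_le_mul₀ (by linarith)]
      have := mul_nonneg (sq_nonneg y) (show 0 ≤ 1 - 2 * y by linarith)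
      linarith
    linarith
  · have := Real.log_le_sub_one_of_pos (show 0 < 1 - y by linarith)
    linarith

theorem pPar_mul_two_pow (m : ℕ) : pPar m * 2 ^ m = 1 := by
  rw [pPar_eq, two_pow_eq, mul_inv_cancel₀ (pow_pos (qRoot_pos m) _).ne']

theorem pPar_mul_wPar_bounds (m : ℕ) : m * Real.log 2 - pPar m ≤ pPar m * wPar m ∧
    pPar m * wPar m ≤ m * Real.log 2 := by
  have h1 := mul_le_mul_of_nonneg_left (wPar_le m) (pPar_pos m).le
  have h2 := mul_le_mul_of_nonneg_left (lt_wPar_add_one m).le (pPar_pos m).le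
  have h3 : pPar m * (m * 2 ^ m * Real.log 2) = m * Real.log 2 := by
    calc _ = (pPar m * 2 ^ m) * (m * Real.log 2) := by ring
      _ = _ := by rw [pPar_mul_two_pow, one_mul]
  rw [h3] at h1 h2
  constructor <;> linarith

theorem Large.qPar_mul_le (h : Large m) : qPar m * m ≤ 1 / 10000 := by
  have := h.mul_pow_le (j := 1) (k := 12) (by norm_num) (by norm_num)
  rw [qPar_eq]; linarith

/-- The exponent in `(1 - t)^(q w) = p e^z`, where `t = q u`. -/
theorem Large.abs_exponent_le (h : Large m) {u e : ℝ} (hu : |u - 1| ≤ e) (he : e ≤ 1 / 400) :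
    |qPar m * wPar m * Real.log (1 - qPar m * u) + m * Real.log 2| ≤
      m * e + 4 * (qPar m * m) := by
  have hm := h.le_cast
  have hq0 := qPar_pos m
  have hp0 := pPar_pos m
  have hq1 := h.qPar_le
  have hqq := qPar_sq m
  have he0 : 0 ≤ e := (abs_nonneg _).trans hu
  obtain ⟨hu1, hu2⟩ := abs_le.1 hu
  have hl2 : Real.log 2 ≤ 1 := by linarith [Real.log_two_lt_d9]
  have hl0 : 0 ≤ Real.log 2 := Real.log_nonneg (by norm_num)
  obtain ⟨hpw2, hpw1⟩ := pPar_mul_wPar_bounds m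
  have hqw : 0 ≤ qPar m * wPar m := by positivity
  have hme : m * Real.log 2 * e ≤ m * e := by
    have := mul_le_mul_of_nonneg_left hl2 (show 0 ≤ (m : ℝ) * e by positivity)
    linarith
  have hpq : pPar m ≤ qPar m := by
    rw [← hqq, sq]; exact mul_le_of_le_one_left hq0.le (by linarith)
  have hy1 : qPar m * u ≤ 1 / 2 := by
    have := mul_le_mul hq1 (show u ≤ 2 by linarith) (by linarith) (by norm_num)
    linarith
  obtain ⟨hlog2, hlog1⟩ := log_one_sub_bounds hy1
  refine abs_le.2 ⟨?_, ?_⟩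
  · have h1 := mul_le_mul_of_nonneg_left hlog2 hqw
    have h1' : qPar m * wPar m * (-(qPar m * u) - 2 * (qPar m * u) ^ 2) =
        -(pPar m * wPar m * (u + 2 * qPar m * u ^ 2)) := by rw [← hqq]; ring
    have h2 : pPar m * wPar m * (u + 2 * qPar m * u ^ 2) ≤
        m * Real.log 2 * (u + 2 * qPar m * u ^ 2) :=
      mul_le_mul_of_nonneg_right hpw1 (by have : 0 ≤ u := by linarith
                                          positivity)
    have h3 : m * Real.log 2 * (u - 1) ≤ m * Real.log 2 * e :=
      mul_le_mul_of_nonneg_left (by linarith) (by positivity)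
    have h5 : u ^ 2 ≤ 2 := by
      have := pow_le_pow_left₀ (show 0 ≤ u by linarith) (show u ≤ 1 + 1 / 400 by linarith) 2
      linarith
    have h6 : m * Real.log 2 * (2 * qPar m * u ^ 2) ≤ m * 1 * (2 * qPar m * 2) := by gcongr
    linarith
  · have h1 := mul_le_mul_of_nonneg_left hlog1 hqw
    have h1' : qPar m * wPar m * (-(qPar m * u)) = -(pPar m * wPar m * u) := by
      rw [← hqq]; ring
    have h2 : (m * Real.log 2 - pPar m) * u ≤ pPar m * wPar m * u :=
      mul_le_mul_of_nonneg_right hpw2 (by linarith)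
    have h3 : m * Real.log 2 * (1 - u) ≤ m * Real.log 2 * e :=
      mul_le_mul_of_nonneg_left (by linarith) (by positivity)
    have h5 : pPar m * u ≤ qPar m * 2 := mul_le_mul hpq (by linarith) (by linarith) hq0.le
    have h6 : qPar m * 100 ≤ qPar m * m := mul_le_mul_of_nonneg_left hm hq0.le
    linarith

/-- One step of the recursion for the parameters `t_k`. -/
theorem Large.abs_step_le (h : Large m) {u e : ℝ} (hu : |u - 1| ≤ e) (he : m * e ≤ 1 / 4) :
    |((1 - qPar m * u) ^ (qPar m * wPar m) - lamPar m) / qPar m / qPar m - 1| ≤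
      2 * m * e + 12 * (m : ℝ) ^ 2 * qRoot m ^ 6 := by
  have hm := h.le_cast
  have hq0 := qPar_pos m
  have hp0 := pPar_pos m
  have hqm := h.qPar_mul_le
  have he0 : 0 ≤ e := (abs_nonneg _).trans hu
  have he1 : e ≤ 1 / 400 := by
    have := mul_le_mul_of_nonneg_right hm he0
    linarith
  have hzabs := h.abs_exponent_le hu he1
  have hy : 0 < 1 - qPar m * u := by
    obtain ⟨hu1, hu2⟩ := abs_le.1 hu
    have := mul_le_mul h.qPar_le (show u ≤ 2 by linarith) (by linarith) (by norm_num)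
    linarith
  set z := qPar m * wPar m * Real.log (1 - qPar m * u) + m * Real.log 2 with hz
  have hpow : (1 - qPar m * u) ^ (qPar m * wPar m) = pPar m * Real.exp z := by
    rw [Real.rpow_def_of_pos hy, pPar, Real.rpow_def_of_pos (by norm_num), ← Real.exp_add, hz]
    congr 1
    ring
  have hexp := Real.abs_exp_sub_one_le (x := z) (by linarith)
  have hnew : ((1 - qPar m * u) ^ (qPar m * wPar m) - lamPar m) / qPar m / qPar m - 1 =
      (Real.exp z - 1) - lamPar m / pPar m := by
    rw [hpow, div_div, ← sq, qPar_sq, sub_div, mul_div_cancel_left₀ _ hp0.ne']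
    ring
  rw [hnew]
  have hlp : lamPar m / pPar m ≤ 4 * (m : ℝ) ^ 2 * qRoot m ^ 6 := by
    rw [div_le_iff₀ hp0, pPar_eq]
    calc _ ≤ _ := h.lamPar_le
      _ = _ := by ring
  have hlp0 : 0 ≤ lamPar m / pPar m := div_nonneg h.lamPar_pos.le hp0.le
  have hqm' : qPar m * m ≤ (m : ℝ) ^ 2 * qRoot m ^ 6 := by
    rw [qPar_eq, mul_comm]
    refine mul_le_mul ?_ ?_ (pow_nonneg (qRoot_pos m).le _) (by positivity)
    · exact le_self_pow₀ (by linarith) (by norm_num)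
    · exact pow_le_pow_of_le_one (qRoot_pos m).le (qRoot_le_one m) (by norm_num)
  calc _ ≤ |Real.exp z - 1| + |lamPar m / pPar m| := abs_sub _ _
    _ ≤ 2 * (m * e + 4 * (qPar m * m)) + 4 * (m : ℝ) ^ 2 * qRoot m ^ 6 := by
        rw [abs_of_nonneg hlp0]
        linarith
    _ ≤ _ := by linarith

/-- The parameters `t_k` stay close to `q`. -/
theorem Large.abs_tAux_le (h : Large m) :
    ∀ j : ℕ, (4 * (m : ℝ)) ^ j * qRoot m ^ 3 ≤ 1 →
      |tAux m j / qPar m - 1| ≤ (4 * (m : ℝ)) ^ j * (12 * (m : ℝ) ^ 2 * qRoot m ^ 6) := by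
  have hm := h.le_cast
  have hQ := qRoot_pos m
  have hq0 := qPar_pos m
  have hp0 := pPar_pos m
  intro j
  induction j with
  | zero =>
    intro _
    have h1 : tAux m 0 / qPar m - 1 = -(lamPar m / pPar m) := by
      rw [tAux, div_div, ← sq, qPar_sq]
      field_simp
      ring
    rw [h1, abs_neg, abs_of_nonneg (div_nonneg h.lamPar_pos.le hp0.le), div_le_iff₀ hp0, pPar_eq]
    have h2 := h.lamPar_le
    have h3 : 0 ≤ (m : ℝ) ^ 2 * qRoot m ^ 30 := by positivity
    calc _ ≤ _ := h2
      _ ≤ 12 * ((m : ℝ) ^ 2 * qRoot m ^ 30) := by linarith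
      _ = _ := by ring
  | succ j ih =>
    intro hj
    have hj' : (4 * (m : ℝ)) ^ j * qRoot m ^ 3 ≤ 1 := by
      refine le_trans ?_ hj
      have : (4 * (m : ℝ)) ^ j ≤ (4 * (m : ℝ)) ^ (j + 1) :=
        pow_le_pow_right₀ (by linarith) (by omega)
      gcongr
    have h1 := ih hj'
    set e := (4 * (m : ℝ)) ^ j * (12 * (m : ℝ) ^ 2 * qRoot m ^ 6) with he
    -- Half of `Q^6` absorbs the growth `(4m)^j`, and the other half the factor `m^3`.
    have h2 : m * e ≤ 1 / 4 := by
      have h3 := h.mul_pow_le (j := 3) (k := 3) le_rfl (by norm_num)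
      have h4 : 0 ≤ (m : ℝ) ^ 3 * qRoot m ^ 3 := by positivity
      calc m * e = 12 * (((4 * (m : ℝ)) ^ j * qRoot m ^ 3) * ((m : ℝ) ^ 3 * qRoot m ^ 3)) := by
            rw [he]; ring
        _ ≤ 12 * (1 * (1 / 10000)) := by gcongr
        _ ≤ _ := by norm_num
    have h3 := h.abs_step_le h1 h2
    rw [mul_div_cancel₀ _ hq0.ne'] at h3
    rw [tAux]
    refine h3.trans ?_
    have h4 : (1 : ℝ) ≤ (4 * (m : ℝ)) ^ j := one_le_pow₀ (by linarith)
    have h5 : 12 * (m : ℝ) ^ 2 * qRoot m ^ 6 ≤ e := by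
      rw [he]; exact le_mul_of_one_le_left (by positivity) h4
    have h6 : (4 * (m : ℝ)) ^ (j + 1) * (12 * (m : ℝ) ^ 2 * qRoot m ^ 6) = 4 * m * e := by
      rw [he]; ring
    rw [h6]
    have h7 : 0 ≤ e := le_trans (by positivity) h5
    nlinarith

/-- The depth is small enough. -/
def Shallow (m d : ℕ) : Prop := (4 * (m : ℝ)) ^ d * qRoot m ^ 3 ≤ 1

/-- The constant `1/16` comes from here: `(4m)^d ≤ m^(2d) = 2^(2d log₂ m) ≤ 2^(m/8) = Q^(-3)`. -/
theorem Large.shallow (h : Large m) {d : ℕ} (hd : (d : ℝ) ≤ 1 / 16 * m / Real.logb 2 m) :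
    Shallow m d := by
  have hm := h.le_cast
  have hlog : 0 < Real.logb 2 m := Real.logb_pos (by norm_num) (by linarith)
  rw [le_div_iff₀ hlog] at hd
  have h1 : (4 * (m : ℝ)) ^ d ≤ (qRoot m ^ 3)⁻¹ := by
    calc (4 * (m : ℝ)) ^ d ≤ ((m : ℝ) * m) ^ d := by gcongr; linarith
      _ = (2 : ℝ) ^ (2 * (d * Real.logb 2 m)) := by
          rw [show 2 * (d * Real.logb 2 (m : ℝ)) = Real.logb 2 m * ((2 * d : ℕ) : ℝ) by
            push_cast; ring, Real.rpow_mul (by norm_num),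
            Real.rpow_logb (by norm_num) (by norm_num) (by linarith), Real.rpow_natCast,
            pow_mul, sq]
      _ ≤ _ := by
          rw [inv_qRoot_pow]
          refine Real.rpow_le_rpow_of_exponent_le (by norm_num) ?_
          push_cast
          linarith
  have h2 := pow_pos (qRoot_pos m) 3
  unfold Shallow
  calc _ ≤ (qRoot m ^ 3)⁻¹ * qRoot m ^ 3 := by gcongr
    _ = 1 := inv_mul_cancel₀ h2.ne'

variable {d : ℕ}

theorem Large.tAux_bounds (h : Large m) (hd : Shallow m d) {j : ℕ} (hj : j ≤ d) :
    3 / 4 * qPar m ≤ tAux m j ∧ tAux m j ≤ 5 / 4 * qPar m := by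
  have hm := h.le_cast
  have hQ := qRoot_pos m
  have hj' : (4 * (m : ℝ)) ^ j * qRoot m ^ 3 ≤ 1 := by
    refine le_trans ?_ hd
    gcongr
    linarith
  have h1 := h.abs_tAux_le j hj'
  have h2 : (4 * (m : ℝ)) ^ j * (12 * (m : ℝ) ^ 2 * qRoot m ^ 6) ≤ 1 / 4 := by
    have h3 := h.mul_pow_le (j := 2) (k := 3) (by norm_num) (by norm_num)
    calc _ = 12 * (((4 * (m : ℝ)) ^ j * qRoot m ^ 3) * ((m : ℝ) ^ 2 * qRoot m ^ 3)) := by ring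
      _ ≤ 12 * (1 * (1 / 10000)) := by gcongr
      _ ≤ _ := by norm_num
  obtain ⟨h3, h4⟩ := abs_le.1 (h1.trans h2)
  have hq0 := qPar_pos m
  rw [← le_div_iff₀ hq0, ← div_le_iff₀ hq0]
  constructor <;> linarith

/-- The free blocks of acceptable size are all `∘` with probability about `p`. -/
theorem Large.one_sub_pow_bounds (h : Large m) (hd : Shallow m d) {k s : ℕ} (hk : 2 ≤ k)
    (hkd : k ≤ d - 1) (hs : Acceptable m d k s) :
    1 / 2 * pPar m ≤ (1 - tPar m d k) ^ s ∧ (1 - tPar m d k) ^ s ≤ 2 * pPar m := by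
  have hm := h.le_cast
  have hQ := qRoot_pos m
  have hq0 := qPar_pos m
  have hq1 := h.qPar_le
  have hp0 := pPar_pos m
  obtain ⟨h1, h2⟩ := h.tAux_bounds hd (show d - 1 - k ≤ d by omega)
  obtain ⟨h3, h4⟩ := h.tAux_bounds hd (show d - 1 - k + 1 ≤ d by omega)
  have hstep : (1 - tAux m (d - 1 - k)) ^ (qPar m * wPar m) =
      lamPar m + qPar m * tAux m (d - 1 - k + 1) := by
    rw [tAux]; field_simp; ring
  unfold tPar
  set t := tAux m (d - 1 - k)
  set t' := tAux m (d - 1 - k + 1)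
  have ht : 0 < 1 - t := by linarith
  have hw1 : (1 : ℝ) ≤ wPar m := le_trans (one_le_pow₀ (by norm_num)) h.two_pow_le_wPar
  -- The exponent of acceptability is at most `1/3 + 1/12 = 5/12`, and `w^(5/12)` is at most `m
  -- 2^(5m/12) = D`. As `t` has order `Q^12`, the product `t D` is tiny, and an acceptable deviation
  -- changes the power only by a constant factor.
  set D : ℝ := m * (qRoot m ^ 10)⁻¹ with hD
  have hD1 : 1 ≤ D := by
    have : 1 ≤ (qRoot m ^ 10)⁻¹ :=
      (one_le_inv₀ (pow_pos hQ _)).2 (pow_le_one₀ hQ.le (qRoot_le_one m))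
    rw [hD]; nlinarith
  have hsD : |(s : ℝ) - qPar m * wPar m| ≤ D := by
    refine le_trans hs ?_
    have hd0 : (0 : ℝ) < d := by
      have : 0 < d := by omega
      exact_mod_cast this
    calc (wPar m : ℝ) ^ (1 / 3 + ((d : ℝ) - k - 1) / (12 * d)) ≤ (wPar m : ℝ) ^ (5 / 12 : ℝ) := by
          refine Real.rpow_le_rpow_of_exponent_le hw1 ?_
          have : ((d : ℝ) - k - 1) / (12 * d) ≤ 1 / 12 := by
            rw [div_le_div_iff₀ (by positivity) (by norm_num)]
            have : (0 : ℝ) ≤ k := Nat.cast_nonneg k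
            linarith
          linarith
      _ ≤ ((m : ℝ) * 2 ^ m) ^ (5 / 12 : ℝ) :=
          Real.rpow_le_rpow (by linarith) (wPar_le' m) (by norm_num)
      _ = (m : ℝ) ^ (5 / 12 : ℝ) * (qRoot m ^ 10)⁻¹ := by
          rw [Real.mul_rpow (by positivity) (by positivity), inv_qRoot_pow, ← Real.rpow_natCast,
            ← Real.rpow_mul (by norm_num)]
          congr 2; push_cast; ring
      _ ≤ (m : ℝ) ^ (1 : ℝ) * (qRoot m ^ 10)⁻¹ := by
          gcongr ?_ * _
          exact Real.rpow_le_rpow_of_exponent_le (by linarith) (by norm_num)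
      _ = D := by rw [Real.rpow_one]
  have htD : t * D ≤ 1 / 4 := by
    have h5 := h.mul_pow_le (j := 1) (k := 2) (by norm_num) le_rfl
    calc t * D ≤ (5 / 4 * qPar m) * D := by gcongr
      _ = 5 / 4 * ((m : ℝ) ^ 1 * qRoot m ^ 2) := by
          rw [hD, qPar_eq]; field_simp
      _ ≤ _ := by linarith
  have hDpow : 3 / 4 ≤ (1 - t) ^ D := by
    have := one_add_mul_self_le_rpow_one_add (s := -t) (by linarith) hD1
    rw [← sub_eq_add_neg] at this
    linarith
  have hDpos : 0 < (1 - t) ^ D := Real.rpow_pos_of_pos ht D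
  have hlam := h.lamPar_le_pPar
  have hlam0 := h.lamPar_pos
  have hqt1 : 3 / 4 * pPar m ≤ qPar m * t' := by rw [← qPar_sq]; nlinarith
  have hqt2 : qPar m * t' ≤ 5 / 4 * pPar m := by rw [← qPar_sq]; nlinarith
  obtain ⟨hs1, hs2⟩ := abs_le.1 hsD
  constructor
  · calc 1 / 2 * pPar m ≤ (lamPar m + qPar m * t') * (3 / 4) := by linarith
      _ ≤ (1 - t) ^ (qPar m * wPar m) * (1 - t) ^ D := by
          rw [hstep]
          gcongr
          linarith
      _ = (1 - t) ^ (qPar m * wPar m + D) := (Real.rpow_add ht _ _).symm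
      _ ≤ (1 - t) ^ (s : ℝ) :=
          Real.rpow_le_rpow_of_exponent_ge ht (by linarith) (by linarith)
      _ = _ := Real.rpow_natCast _ _
  · have h6 : (1 - t) ^ (s : ℝ) * (1 - t) ^ D ≤ lamPar m + qPar m * t' := by
      rw [← hstep, ← Real.rpow_add ht]
      exact Real.rpow_le_rpow_of_exponent_ge ht (by linarith) (by linarith)
    rw [Real.rpow_natCast] at h6
    have h7 : 0 ≤ (1 - t) ^ s := pow_nonneg ht.le s
    nlinarith

theorem Large.qBlock_bounds (h : Large m) (hd : Shallow m d) {k s : ℕ} (hk : 2 ≤ k)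
    (hkd : k ≤ d - 1) (hs : Acceptable m d k s) :
    0 ≤ qBlock m d k s ∧ qBlock m d k s ≤ 3 * qPar m := by
  obtain ⟨h1, h2⟩ := h.one_sub_pow_bounds hd hk hkd hs
  obtain ⟨h3, h4⟩ := h.tAux_bounds hd (show d - 1 - (k - 1) ≤ d by omega)
  have hq0 := qPar_pos m
  have hp0 := pPar_pos m
  have hlam := h.lamPar_le_pPar
  have hlam0 := h.lamPar_pos
  have ht : 0 < tPar m d (k - 1) := lt_of_lt_of_le (by positivity) h3
  unfold qBlock
  refine ⟨div_nonneg (by linarith) ht.le, ?_⟩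
  rw [div_le_iff₀ ht]
  have h5 : 3 * qPar m * (3 / 4 * qPar m) ≤ 3 * qPar m * tPar m d (k - 1) := by gcongr; exact h3
  have h6 : 3 * qPar m * (3 / 4 * qPar m) = 9 / 4 * pPar m := by rw [← qPar_sq]; ring
  linarith

theorem Large.tPar_bounds (h : Large m) (hd : Shallow m d) (k : ℕ) :
    0 < tPar m d k ∧ tPar m d k ≤ 5 / 4 * qPar m := by
  obtain ⟨h1, h2⟩ := h.tAux_bounds hd (show d - 1 - k ≤ d by omega)
  have hq0 := qPar_pos m
  exact ⟨lt_of_lt_of_le (by positivity) h1, h2⟩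

theorem Large.paramsValid (h : Large m) (hd : Shallow m d) : ParamsValid m d := by
  have hq1 := h.qPar_le
  have hp1 := h.pPar_le
  have hlam := h.lamPar_le_pPar
  refine ⟨h.lamPar_pos.le, by linarith, fun k _ _ => ?_, fun k s hk hkd hs => ?_⟩
  · obtain ⟨h1, h2⟩ := h.tPar_bounds hd k
    exact ⟨h1, by linarith⟩
  · obtain ⟨h1, h2⟩ := h.qBlock_bounds hd hk hkd hs
    exact ⟨h1, by linarith⟩

end Parameters

/-! ### Choice of the constants and proof of the theorem. -/

section Conclusion

variable {m d : ℕ}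

theorem BlockGood.mono {l : ℕ} {b : Bool} {r : ℕ} {δ δ' : ℝ} {μ : (Fin l → Option Bool) → ℝ}
    (h : BlockGood b r δ μ) (hδ : δ ≤ δ') : BlockGood b r δ' μ :=
  ⟨h.1, fun U hU y => (h.2 U hU y).trans (mul_le_mul_of_nonneg_right hδ (h.1 y))⟩

theorem one_add_pow_le_two {x : ℝ} (hx : 0 ≤ x) {r : ℕ} (h : r * x ≤ 1 / 2) :
    (1 + x) ^ r ≤ 2 := by
  have h1 : (1 + x) ^ r ≤ Real.exp (r * x) := by
    rw [Real.exp_nat_mul]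
    exact pow_le_pow_left₀ (by linarith) (by linarith [Real.add_one_le_exp x]) r
  have h2 : Real.exp (r * x) ≤ Real.exp (Real.log 2) :=
    Real.exp_le_exp.2 (by linarith [Real.log_two_gt_d9])
  rw [Real.exp_log (by norm_num)] at h2
  exact h1.trans h2

/-- Comparing `q p = Q^36` with `λ ≥ Q^30` gives `δ = 2 Q^6` before encoding. With `t = 1/2`,
encoding `m/6` coordinates costs `2^(m/6) ≤ Q^(-4)`, which leaves `2 Q^2`; this is where a small
bottom fan-in is needed. -/
theorem Large.simplifies_init (h : Large m) (j : ℕ) (hj : j + 1 = d) :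
    BlockGood (l := fanIn m d j) false (m / 6) (2 * qRoot m ^ 2)
      (mixWeight (lamPar m) (qPar m) true (1 / 2) fun _ => none) ∧
    ∑ x : Fin (fanIn m d j) → Option Bool,
      mixWeight (lamPar m) (qPar m) true (1 / 2) (fun _ => none) x = 1 := by
  have hm := h.le_cast
  have hQ := qRoot_pos m
  have hq0 := qPar_pos m
  have hq1 := h.qPar_le
  have hp0 := pPar_pos m
  have hp1 := h.pPar_le
  have hlam := h.lamPar_le_pPar
  have hlam0 := h.lamPar_pos
  have hl : fanIn m d j = m := by rw [fanIn, if_pos (by omega)]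
  rw [hl]
  have hstars : stars (fun _ : Fin m => (none : Option Bool)) = m := by simp [stars]
  have hpow : (1 - 1 / 2 : ℝ) ^ m = pPar m := by
    have h1 := pPar_mul_two_pow m
    rw [show (1 - 1 / 2 : ℝ) = 2⁻¹ by norm_num, inv_pow]
    field_simp
    linarith
  constructor
  · refine (blockGood_mixWeight (δ := 2 * qRoot m ^ 6) (by positivity) hlam0.le hq0.le (by linarith)
      (by norm_num) (by norm_num) (m / 6) _ (by rw [hstars]; linarith [h.le]) ?_ ?_).mono ?_
    · have h1 : qPar m ≤ qRoot m ^ 6 := by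
        rw [qPar_eq]; exact pow_le_pow_of_le_one hQ.le (qRoot_le_one m) (by norm_num)
      have h2 : qRoot m ^ 6 * (1 / 2) ≤ qRoot m ^ 6 * (1 - lamPar m - qPar m) := by
        gcongr; linarith
      linarith
    · rw [hstars, hpow]
      have h1 : qPar m * pPar m = qRoot m ^ 6 * qRoot m ^ 30 := by rw [qPar_eq, pPar_eq]; ring
      rw [h1]
      have h2 : qRoot m ^ 6 * (qRoot m ^ 30 * (1 / 2)) ≤
          qRoot m ^ 6 * (lamPar m * (1 - pPar m)) := by
        gcongr
        · exact h.le_lamPar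
        · linarith
      linarith
    · have h1 : (1 / (1 - 1 / 2) : ℝ) ^ (m / 6) ≤ (qRoot m ^ 4)⁻¹ := by
        rw [show (1 / (1 - 1 / 2) : ℝ) = 2 by norm_num, inv_qRoot_pow, ← Real.rpow_natCast]
        refine Real.rpow_le_rpow_of_exponent_le (by norm_num) ?_
        have := Nat.cast_div_le (α := ℝ) (m := m) (n := 6)
        push_cast at this ⊢
        linarith
      calc _ ≤ 2 * qRoot m ^ 6 * (qRoot m ^ 4)⁻¹ := by gcongr
        _ = _ := by field_simp
  · refine sum_mixWeight _ _ _ _ ?_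
    rw [hstars, hpow]
    linarith

/-- As in the initial stage, now with `q_a ≤ 3q` and `(1 - t)^|S| ≤ 2p`, which gives `12 Q^6`.
Because `s t` is small, encoding `s` coordinates costs only a factor 2, even though `s` is
exponential in `m`. -/
theorem Large.simplifies_next (h : Large m) (hd : Shallow m d) {s : ℕ}
    (hs : (s : ℝ) ≤ m * (qRoot m ^ 4)⁻¹) {k : ℕ} (hk : 2 ≤ k) (hkd : k ≤ d - 1) (l : ℕ)
    (liftVal : Option Bool) (τ : Fin l → Option Bool) (hτ : liftVal = none → 0 < stars τ) :
    BlockGood (!circ d k) s (24 * qRoot m ^ 6) (blockWeight m d k liftVal τ) ∧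
      ∑ x, blockWeight m d k liftVal τ x = 1 := by
  have hm := h.le_cast
  have hQ := qRoot_pos m
  have hq0 := qPar_pos m
  have hq1 := h.qPar_le
  have hp0 := pPar_pos m
  have hp1 := h.pPar_le
  have hlam := h.lamPar_le_pPar
  have hlam0 := h.lamPar_pos
  obtain ⟨ht0, ht1⟩ := h.tPar_bounds hd k
  by_cases hc : liftVal = none ∧ Acceptable m d k (stars τ)
  · have hw : blockWeight m d k liftVal τ =
        mixWeight (lamPar m) (qBlock m d k (stars τ)) (circ d k) (tPar m d k) τ := by
      funext σ; rw [blockWeight, if_pos hc]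
    rw [hw]
    obtain ⟨hqb0, hqb1⟩ := h.qBlock_bounds hd hk hkd hc.2
    obtain ⟨hS0, hS1⟩ := h.one_sub_pow_bounds hd hk hkd hc.2
    constructor
    · refine (blockGood_mixWeight (δ := 12 * qRoot m ^ 6) (by positivity) hlam0.le hqb0
        (by linarith) ht0 (by linarith) s τ (hτ hc.1) ?_ ?_).mono ?_
      · have h1 : qPar m ≤ qRoot m ^ 6 := by
          rw [qPar_eq]; exact pow_le_pow_of_le_one hQ.le (qRoot_le_one m) (by norm_num)
        have h2 : qRoot m ^ 6 * (1 / 2) ≤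
            qRoot m ^ 6 * (1 - lamPar m - qBlock m d k (stars τ)) := by
          gcongr; linarith
        linarith
      · have h1 : qPar m * pPar m = qRoot m ^ 6 * qRoot m ^ 30 := by rw [qPar_eq, pPar_eq]; ring
        have h2 : qRoot m ^ 6 * (qRoot m ^ 30 * (1 / 2)) ≤
            qRoot m ^ 6 * (lamPar m * (1 - (1 - tPar m d k) ^ stars τ)) := by
          gcongr
          · exact h.le_lamPar
          · linarith
        have h3 : qBlock m d k (stars τ) * (1 - tPar m d k) ^ stars τ ≤
            3 * qPar m * (2 * pPar m) :=
          mul_le_mul hqb1 hS1 (by linarith) (by positivity)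
        linarith
      · have h1 : s * tPar m d k ≤ 1 / 2 := by
          have h2 := h.mul_pow_le (j := 1) (k := 8) (by norm_num) (by norm_num)
          calc s * tPar m d k ≤ m * (qRoot m ^ 4)⁻¹ * (5 / 4 * qPar m) := by gcongr
            _ = 5 / 4 * ((m : ℝ) ^ 1 * qRoot m ^ 8) := by rw [qPar_eq]; field_simp
            _ ≤ _ := by linarith
        have h2 : 1 / 2 ≤ (1 - tPar m d k) ^ s := by
          have := one_add_mul_le_pow (a := -tPar m d k) (by linarith) s
          rw [← sub_eq_add_neg] at this
          linarith
        have h3 : (1 / (1 - tPar m d k)) ^ s ≤ 2 := by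
          rw [div_pow, one_pow, div_le_iff₀ (by linarith)]
          linarith
        calc _ ≤ 12 * qRoot m ^ 6 * 2 := by gcongr
          _ = _ := by ring
    · refine sum_mixWeight _ _ _ _ ?_
      linarith
  · have hw : blockWeight m d k liftVal τ =
        prodWeight (some (!circ d k)) (circ d k) (tPar m d k) τ := by
      funext σ; rw [blockWeight, if_neg hc]
    rw [hw]
    exact ⟨blockGood_prodWeight (by positivity) ht0.le (by linarith) s τ,
      sum_prodWeight (by simp) _ τ⟩

theorem Large.simplifies (h : Large m) (hd : Shallow m d) {s : ℕ} (hs1 : 1 ≤ s)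
    (hs : (s : ℝ) ≤ m * (qRoot m ^ 4)⁻¹) : Simplifies m d (m / 6) s (1 / 4) := by
  have hm := h.le_cast
  have hQ := qRoot_pos m
  refine ⟨by have := h.le; omega, hs1, by norm_num, by norm_num,
    ⟨2 * qRoot m ^ 2, by positivity, one_add_pow_le_two (by positivity) ?_,
      fun j hj => h.simplifies_init j hj⟩,
    ⟨24 * qRoot m ^ 6, by positivity, one_add_pow_le_two (by positivity) ?_,
      fun k hk hkd l v τ hτ => h.simplifies_next hd hs hk hkd l v τ hτ⟩⟩
  · have h1 := h.mul_pow_le (j := 1) (k := 2) (by norm_num) le_rfl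
    have h2 : ((m / 6 : ℕ) : ℝ) ≤ m := by exact_mod_cast Nat.div_le_self m 6
    calc ((m / 6 : ℕ) : ℝ) * (2 * (2 * qRoot m ^ 2) / (1 / 4)) ≤
          m * (2 * (2 * qRoot m ^ 2) / (1 / 4)) := by gcongr
      _ = 16 * ((m : ℝ) ^ 1 * qRoot m ^ 2) := by ring
      _ ≤ _ := by linarith
  · have h1 := h.mul_pow_le (j := 1) (k := 2) (by norm_num) le_rfl
    calc (s : ℝ) * (2 * (24 * qRoot m ^ 6) / (1 / 4)) ≤
          m * (qRoot m ^ 4)⁻¹ * (2 * (24 * qRoot m ^ 6) / (1 / 4)) := by gcongr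
      _ = 192 * ((m : ℝ) ^ 1 * qRoot m ^ 2) := by field_simp; ring
      _ ≤ _ := by linarith

/-- The number `2^m` already qualifies, because `q 2^m t_1 ≥ 3/4 > log 2`. -/
theorem Large.w0Par_bounds (h : Large m) (hd : Shallow m d) :
    1 ≤ w0Par m d ∧ w0Par m d ≤ 2 ^ m := by
  have hq0 := qPar_pos m
  have hq1 := h.qPar_le
  obtain ⟨ht1, ht2⟩ := h.tAux_bounds hd (show d - 1 - 1 ≤ d by omega)
  have hmem : 2 ^ m ∈ {N : ℕ | (1 - tPar m d 1) ^ (qPar m * N) ≤ 1 / 2} := by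
    change (1 - tAux m (d - 1 - 1)) ^ (qPar m * ((2 ^ m : ℕ) : ℝ)) ≤ 1 / 2
    set t := tAux m (d - 1 - 1)
    have ht : 0 < 1 - t := by linarith
    have h1 : Real.log (1 - t) ≤ -t := by
      have := Real.log_le_sub_one_of_pos ht; linarith
    have h2 : 0 ≤ qPar m * 2 ^ m := by positivity
    have h3 : qPar m * 2 ^ m * qPar m = 1 := by
      rw [← pPar_mul_two_pow m, ← qPar_sq]; ring
    have h4 : 3 / 4 ≤ qPar m * 2 ^ m * t := by
      calc (3 / 4 : ℝ) = qPar m * 2 ^ m * (3 / 4 * qPar m) := by linarith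
        _ ≤ _ := mul_le_mul_of_nonneg_left ht1 h2
    rw [Real.rpow_def_of_pos ht, ← Real.le_log_iff_exp_le (by norm_num), one_div, Real.log_inv]
    push_cast
    have h5 := mul_le_mul_of_nonneg_left h1 h2
    have h6 := Real.log_two_lt_d9
    linarith
  refine ⟨?_, Nat.sInf_le hmem⟩
  have h1 := Nat.sInf_mem (s := {N : ℕ | (1 - tPar m d 1) ^ (qPar m * N) ≤ 1 / 2}) ⟨_, hmem⟩
  by_contra hcon
  have h0 : w0Par m d = 0 := by omega
  unfold w0Par at h0
  rw [h0] at h1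
  simp only [Set.mem_ofPred_eq, Nat.cast_zero, mul_zero, Real.rpow_zero] at h1
  norm_num at h1

theorem Large.numVars_bounds (h : Large m) (hd : Shallow m d) (hd2 : 2 ≤ d) :
    1 ≤ numVars m d ∧ (numVars m d : ℝ) ≤ ((m : ℝ) * 2 ^ m) ^ (d - 1) := by
  obtain ⟨e, rfl⟩ : ∃ e, d = e + 2 := ⟨d - 2, by omega⟩
  obtain ⟨h1, h2⟩ := h.w0Par_bounds hd
  have hw1 : 1 ≤ wPar m := by
    have := (one_le_pow₀ (by norm_num : (1 : ℝ) ≤ 2)).trans h.two_pow_le_wPar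
    exact_mod_cast this
  have hn : numVars m (e + 2) = wPar m ^ e * w0Par m (e + 2) * m := by
    rw [numVars, Finset.prod_range_succ, Finset.prod_range_succ']
    congr 2
    · rw [Finset.prod_congr rfl (g := fun _ => wPar m), Finset.prod_const, Finset.card_range]
      intro k hk
      rw [Finset.mem_range] at hk
      rw [fanIn, if_neg (by omega), if_neg (by omega)]
    · rw [fanIn, if_pos (by omega)]
  rw [hn]
  constructor
  · have := h.le
    exact Nat.one_le_iff_ne_zero.2 (by positivity)
  · push_cast
    calc (wPar m : ℝ) ^ e * w0Par m (e + 2) * m ≤ ((m : ℝ) * 2 ^ m) ^ e * 2 ^ m * m := by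
          gcongr
          · exact wPar_le' m
          · exact_mod_cast h2
      _ = ((m : ℝ) * 2 ^ m) ^ (e + 2 - 1) := by
          rw [show e + 2 - 1 = e + 1 by omega, pow_succ]; ring

/-- The fan-in bound of the theorem is at most `m / 6`. -/
theorem Large.bottomFanIn_le (h : Large m) (hd : Shallow m d) (hd2 : 2 ≤ d) {r : ℕ}
    (hr : (r : ℝ) ≤ Real.logb 2 (numVars m d) / (10 * ((d : ℝ) - 1))) : r ≤ m / 6 := by
  have hm := h.le_cast
  obtain ⟨h1, h2⟩ := h.numVars_bounds hd hd2
  have hd1 : (1 : ℝ) ≤ (d : ℝ) - 1 := by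
    have : (2 : ℝ) ≤ d := by exact_mod_cast hd2
    linarith
  have hn1 : (1 : ℝ) ≤ numVars m d := by exact_mod_cast h1
  -- Taking logarithms in `m^3 Q^2 ≤ 1` gives `3 log₂ m ≤ m/12`.
  have hlogm : Real.logb 2 m ≤ m / 36 := by
    have h3 : (m : ℝ) ^ 3 ≤ (qRoot m ^ 2)⁻¹ := by
      rw [← one_div, le_div_iff₀ (pow_pos (qRoot_pos m) 2)]
      linarith [h.mul_pow_le (j := 3) (k := 2) le_rfl le_rfl]
    rw [inv_qRoot_pow, ← Real.logb_le_iff_le_rpow (by norm_num) (by positivity),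
      Real.logb_pow] at h3
    push_cast at h3
    linarith
  have hlogn : Real.logb 2 (numVars m d) ≤ ((d : ℝ) - 1) * (Real.logb 2 m + m) := by
    have h3 := Real.logb_le_logb_of_le (b := 2) (by norm_num) (by linarith) h2
    rw [Real.logb_pow, Real.logb_mul (by positivity) (by positivity), Real.logb_pow,
      Real.logb_self_eq_one (by norm_num), mul_one, Nat.cast_sub (by omega), Nat.cast_one] at h3
    exact h3
  have h5 : (r : ℝ) ≤ m / 8 := by
    refine hr.trans ?_
    rw [div_le_iff₀ (by positivity)]
    have : ((d : ℝ) - 1) * (Real.logb 2 m + m) ≤ ((d : ℝ) - 1) * (m / 36 + m) := by gcongr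
    nlinarith
  rw [Nat.le_div_iff_mul_le (by norm_num)]
  have h6 : (r : ℝ) * 6 ≤ m := by linarith
  exact_mod_cast h6

theorem Large.numVars_rpow_le (h : Large m) (hd : Shallow m d) (hd2 : 2 ≤ d) :
    (numVars m d : ℝ) ^ (1 / (6 * ((d : ℝ) - 1))) ≤ m * (qRoot m ^ 4)⁻¹ := by
  have hm := h.le_cast
  obtain ⟨h1, h2⟩ := h.numVars_bounds hd hd2
  have hd1 : (1 : ℝ) ≤ (d : ℝ) - 1 := by
    have : (2 : ℝ) ≤ d := by exact_mod_cast hd2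
    linarith
  calc (numVars m d : ℝ) ^ (1 / (6 * ((d : ℝ) - 1))) ≤
        (((m : ℝ) * 2 ^ m) ^ (d - 1)) ^ (1 / (6 * ((d : ℝ) - 1))) :=
        Real.rpow_le_rpow (by positivity) h2 (by positivity)
    _ = ((m : ℝ) * 2 ^ m) ^ (1 / 6 : ℝ) := by
        rw [← Real.rpow_natCast _ (d - 1), ← Real.rpow_mul (by positivity),
          Nat.cast_sub (by omega), Nat.cast_one]
        congr 1
        field_simp
    _ = (m : ℝ) ^ (1 / 6 : ℝ) * (qRoot m ^ 4)⁻¹ := by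
        rw [Real.mul_rpow (by positivity) (by positivity), inv_qRoot_pow, ← Real.rpow_natCast,
          ← Real.rpow_mul (by norm_num)]
        congr 2; push_cast; ring
    _ ≤ (m : ℝ) ^ (1 : ℝ) * (qRoot m ^ 4)⁻¹ := by
        have := inv_nonneg.2 (pow_nonneg (qRoot_pos m).le 4)
        gcongr ?_ * _
        exact Real.rpow_le_rpow_of_exponent_le (by linarith) (by norm_num)
    _ = _ := by rw [Real.rpow_one]

theorem Large.probShallow_ge (h : Large m) (hd : Shallow m d) (hd2 : 2 ≤ d)
    (C : LayeredCircuit (SAddr m d d) d)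
    (hC : (C.bottomFanIn : ℝ) ≤ Real.logb 2 (numVars m d) / (10 * ((d : ℝ) - 1)))
    (hS : (C.size : ℝ) ≤ (2 : ℝ) ^ ((numVars m d : ℝ) ^ (1 / (6 * ((d : ℝ) - 1))))) :
    1 - Real.exp (-(Real.log 2 * (numVars m d : ℝ) ^ (1 / (6 * ((d : ℝ) - 1))))) ≤
      probShallow m d C.eval ((numVars m d : ℝ) ^ (1 / (4 * ((d : ℝ) - 1)))) := by
  have hd1 : (1 : ℝ) ≤ (d : ℝ) - 1 := by
    have : (2 : ℝ) ≤ d := by exact_mod_cast hd2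
    linarith
  have hn1 : (1 : ℝ) ≤ numVars m d := by exact_mod_cast (h.numVars_bounds hd hd2).1
  have hNs := h.numVars_rpow_le hd hd2
  have hN1 : 1 ≤ (numVars m d : ℝ) ^ (1 / (6 * ((d : ℝ) - 1))) :=
    Real.one_le_rpow hn1 (by positivity)
  have hN4 : (numVars m d : ℝ) ^ (1 / (6 * ((d : ℝ) - 1))) ≤
      (numVars m d : ℝ) ^ (1 / (4 * ((d : ℝ) - 1))) := by
    refine Real.rpow_le_rpow_of_exponent_le hn1 ?_
    exact one_div_le_one_div_of_le (by positivity) (by linarith)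
  generalize (numVars m d : ℝ) ^ (1 / (6 * ((d : ℝ) - 1))) = N at *
  have hfl : (⌊N⌋₊ : ℝ) ≤ N := Nat.floor_le (by linarith)
  have hmain := one_sub_le_probShallow hd2
    (h.simplifies hd (Nat.one_le_floor_iff N |>.2 hN1) (hfl.trans hNs)) C
    (h.bottomFanIn_le hd hd2 hC) (hfl.trans hN4)
  refine le_trans (sub_le_sub_left ?_ 1) hmain
  -- The exponent `s + 1` in the failure bound makes up for rounding `N` down.
  have h1 : (1 / 4 : ℝ) ^ (⌊N⌋₊ + 1) ≤ (1 / 4 : ℝ) ^ N := by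
    rw [← Real.rpow_natCast]
    refine Real.rpow_le_rpow_of_exponent_ge (by norm_num) (by norm_num) ?_
    push_cast
    exact (Nat.lt_floor_add_one N).le
  calc (C.size : ℝ) * (1 / 4) ^ (⌊N⌋₊ + 1) ≤ 2 ^ N * (1 / 4 : ℝ) ^ N := by gcongr
    _ = (1 / 2 : ℝ) ^ N := by
        rw [← Real.mul_rpow (by norm_num) (by norm_num)]; norm_num
    _ = _ := by
        rw [Real.rpow_def_of_pos (by norm_num), one_div, Real.log_inv]
        congr 1; ring

end Conclusion

end SipserProj

end

theorem mainTheorem9 :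
    ∃ (c κ : ℝ) (m₀ : ℕ), 0 < c ∧ 0 < κ ∧
      ∀ m d : ℕ, m₀ ≤ m → 2 ≤ d → (d : ℝ) ≤ c * m / Real.logb 2 m →
        SipserProj.ParamsValid m d ∧
        ∀ C : SipserProj.LayeredCircuit (SipserProj.SAddr m d d) d,
          (C.bottomFanIn : ℝ) ≤
            Real.logb 2 (SipserProj.numVars m d) / (10 * ((d : ℝ) - 1)) →
          (C.size : ℝ) ≤
            (2 : ℝ) ^ ((SipserProj.numVars m d : ℝ) ^ (1 / (6 * ((d : ℝ) - 1)))) →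
          1 - Real.exp (-(κ * (SipserProj.numVars m d : ℝ) ^ (1 / (6 * ((d : ℝ) - 1))))) ≤
            SipserProj.probShallow m d C.eval
              ((SipserProj.numVars m d : ℝ) ^ (1 / (4 * ((d : ℝ) - 1)))) := by

  obtain ⟨m₀, hm₀⟩ := SipserProj.exists_forall_large
  refine ⟨1 / 16, Real.log 2, m₀, by norm_num, Real.log_pos (by norm_num), fun m d hm hd2 hd => ?_⟩
  have h := hm₀ m hm
  have hs := h.shallow hd
  exact ⟨h.paramsValid hs, fun C hC hS => h.probShallow_ge hs hd2 C hC hS⟩
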